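/- Let $l\ge 1$ be an integer and let $$K_l=\Big\{\sum_{i=1}^{\infty}\frac{\varepsilon_i}{(2l+2)^i} : \varepsilon_i\in\{0,2,4,\dots,2l,\,2l+1,2l+3,\dots,4l+1\}\text{ for all } i\ge 1\Big\}\subset\mathbb{R}.$$ For $1\le i\le 2l+2$ let $\psi_i(x)=\frac{x+2i-2}{2l+2}$ if $i\le l+1$ and $\psi_i(x)=\frac{x+2i-3}{2l+2}$ if $i\ge l+2$. For $n\ge 1$ put $\varphi_{n,i}=\psi_{l+1}^{\,n-1}\circ\psi_i$ if $1\le i\le l$, and $\varphi_{n,i}=\psi_{l+2}^{\,n-1}\circ\psi_i$ if $l+3\le i\le 2l+2$, where the exponent denotes iteration under composition. Let $\operatorname{fr}K_l$ be the topological boundary of $K_l$ in $\mathbb{R}$. Then: 1. $K_l$ is a Cantorval, that is, $K_l$ is homeomorphic to $C\cup\bigcup_{n\ge 1}G_{2n-1}$, where $C$ is the Cantor ternary set and $G_n$ is the union of the $2^{n-1}$ open middle thirds removed from $[0,1]$ at the $n$-th step of the construction of $C$. 2. The Lebesgue measure of $K_l$ is $1$. 3. The Hausdorff dimension of $\operatorname{fr}K_l$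 is $\log(2l+1)/\log(2l+2)$, and this number is not an integer. 4. $\operatorname{fr}K_l$ is a countable self-similar set in the following sense. For each $n\ge 1$ there are exactly $2l$ maps $\varphi_{n,i}$, $i\in J:=\{1,\dots,l\}\cup\{l+3,\dots,2l+2\}$, and each of them is a similarity of $\mathbb{R}$ with ratio $(2l+2)^{-n}$. The copies $\varphi_{n,i}(\operatorname{fr}K_l)$, $n\ge 1$, $i\in J$, are pairwise disjoint. The points $\frac{2l}{2l+1}$ and $1$ belong to $\operatorname{fr}K_l$, and $$\bigcup_{n\ge 1}\bigcup_{i\in J}\varphi_{n,i}(\operatorname{fr}K_l)=\operatorname{fr}K_l\setminus\Big\{\frac{2l}{2l+1},\,1\Big\},\qquad \overline{\bigcup_{n\ge 1}\bigcup_{i\in J}\varphi_{n,i}(\operatorname{fr}K_l)}=\operatorname{fr}K_l .$$ -/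

import Mathlib

/-- The digit set `{0, 2, 4, …, 2l, 2l+1, 2l+3, …, 4l+1}`. -/
def digitSet (l : ℕ) : Set ℕ :=
  {d | ∃ k ≤ l, d = 2 * k ∨ d = 2 * l + 1 + 2 * k}

/-- The set `K_l` of all sums `∑_{i ≥ 1} ε_i / (2l+2)^i` with digits `ε_i` in `digitSet l`.
The sequence is indexed from `0` here, so that `ε i` is the digit at position `i + 1`. -/
def selfSimilarK (l : ℕ) : Set ℝ :=
  {x | ∃ ε : ℕ → ℕ, (∀ i, ε i ∈ digitSet l) ∧
    HasSum (fun i => (ε i : ℝ) / (2 * (l : ℝ) + 2) ^ (i + 1)) x}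

/-- The union `G_n` of the `2^(n-1)` open middle thirds that are removed at the `n`-th step
(`n ≥ 1`) of the construction of the Cantor ternary set. -/
def removedThirds (n : ℕ) : Set ℝ := preCantorSet (n - 1) \ preCantorSet n

/-- The model Cantorval `C ∪ G_1 ∪ G_3 ∪ G_5 ∪ …`. -/
def modelCantorval : Set ℝ := cantorSet ∪ ⋃ n : ℕ, removedThirds (2 * n + 1)

/-- A set of reals is a Cantorval (M-Cantorval) if it is homeomorphic to the model. -/
def IsCantorval (S : Set ℝ) : Prop := Nonempty (S ≃ₜ modelCantorval)

/-- The maps `ψ_i`, `1 ≤ i ≤ 2l+2`, of the iterated function system that generates `K_l`. -/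
noncomputable def psi (l i : ℕ) (x : ℝ) : ℝ :=
  if i ≤ l + 1 then (x + (2 * (i : ℝ) - 2)) / (2 * (l : ℝ) + 2)
  else (x + (2 * (i : ℝ) - 3)) / (2 * (l : ℝ) + 2)

/-- The indices `{1, …, l} ∪ {l+3, …, 2l+2}`. -/
def outerIndices (l : ℕ) : Finset ℕ := Finset.Icc 1 l ∪ Finset.Icc (l + 3) (2 * l + 2)

/-- The map `ψ_{l+1}^n ∘ ψ_i` for `i ≤ l`, and `ψ_{l+2}^n ∘ ψ_i` for `i ≥ l+3`. -/
noncomputable def copyMap (l n i : ℕ) : ℝ → ℝ :=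
  (psi l (if i ≤ l then l + 1 else l + 2))^[n] ∘ psi l i

open Set Filter Topology MeasureTheory
open scoped Pointwise ENNReal NNReal

/-! Write b = 2l+2, K = K_l and p = 2l/(2l+1), so that K lies in [0, 1+p] with p < 1. The digits
form a complete residue system modulo b, hence the integer translates of K cover the line
(`exists_int_sub_mem_selfSimilarK`), and only neighbouring translates can meet. Everything is read
off from the overlap A = K ∩ (K - 1).

Comparing the first digits of x and x + 1 shows that A is exactly the set of sums in base b with
digits 0, ..., 2l: a Cantor set in which a single digit is forbidden (`overlapSet_uncons`,
`overlapSet_cons`). An even leading digit preserves the memberships in K and K - 1, an odd one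
exchanges them. Since (p, 1) lies in K and not in K - 1, the gaps of A are of two kinds, in K only
or in K - 1 only, and both kinds accumulate at every point of A (`exists_gaps_overlapSet`). With the
covering property this gives fr K = A ∪ (A + 1).

The dimension of A is bounded above by the natural covers, and below by rereading expansions from
base 2l+2 in base 2l+1, which is a Hölder map onto a set containing [0, 1). In particular A is null,
so K cut at 1 and folded into [0, 1) covers it essentially once and has measure 1. The copies sort A
by the number of leading digits 2l, and A + 1 by the number of leading digits 0; the two constant
sequences give the exceptional points.

For the Cantorval, colour each gap of the boundary by whether it lies in the set. The gaps then form
a countable order without end points in which both colours are dense, so a coloured back-and-forth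
matches the gaps of fr K with those of the Cantor set, and the matching extends to the convex hulls
(`IsCantorvalWithBoundary.nonempty_homeomorph`). -/

/-- The set of all sums `∑ ε i / b ^ (i + 1)` with digits `ε i` in `D`. -/
def digitSums (b : ℝ) (D : Set ℕ) : Set ℝ :=
  {x | ∃ ε : ℕ → ℕ, (∀ i, ε i ∈ D) ∧ HasSum (fun i => (ε i : ℝ) / b ^ (i + 1)) x}

/-! ### Sums of digit expansions in a real base -/

section DigitSums

variable {b : ℝ} {D : Set ℕ}

lemma hasSum_digits_cons (hb : 1 < b) {ε : ℕ → ℕ} {x : ℝ}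
    (h : HasSum (fun i => (ε (i + 1) : ℝ) / b ^ (i + 1)) x) :
    HasSum (fun i => (ε i : ℝ) / b ^ (i + 1)) ((x + ε 0) / b) := by
  have hb0 : b ≠ 0 := by positivity
  rw [← hasSum_nat_add_iff' 1]
  have h' := h.div_const b
  simp only [div_div, ← pow_succ] at h'
  have hv : (x + ε 0) / b - ∑ i ∈ Finset.range 1, (ε i : ℝ) / b ^ (i + 1) = x / b := by
    simp
    field_simp
    ring
  rw [hv]
  exact h'

lemma hasSum_digits_tail (hb : 1 < b) {ε : ℕ → ℕ} {x : ℝ}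
    (h : HasSum (fun i => (ε i : ℝ) / b ^ (i + 1)) x) :
    HasSum (fun i => (ε (i + 1) : ℝ) / b ^ (i + 1)) (b * x - ε 0) := by
  have hb0 : b ≠ 0 := by positivity
  rw [← hasSum_nat_add_iff' 1] at h
  have h' := h.mul_left b
  have heq : ∀ i, b * ((ε (i + 1) : ℝ) / b ^ (i + 1 + 1)) = ε (i + 1) / b ^ (i + 1) := fun i => by
    field_simp
    ring
  simp only [heq] at h'
  have hv : b * (x - ∑ i ∈ Finset.range 1, (ε i : ℝ) / b ^ (i + 1)) = b * x - ε 0 := by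
    simp [mul_sub]
    field_simp
  rwa [hv] at h'

lemma digitSums_cons (hb : 1 < b) {d : ℕ} (hd : d ∈ D) {x : ℝ} (hx : x ∈ digitSums b D) :
    (x + d) / b ∈ digitSums b D := by
  obtain ⟨ε, hε, hs⟩ := hx
  refine ⟨fun i => Nat.casesOn i d ε, fun i => ?_, hasSum_digits_cons hb (by simpa using hs)⟩
  cases i
  exacts [hd, hε _]

lemma digitSums_uncons (hb : 1 < b) {x : ℝ} (hx : x ∈ digitSums b D) :
    ∃ d ∈ D, ∃ y ∈ digitSums b D, x = (y + d) / b := by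
  obtain ⟨ε, hε, hs⟩ := hx
  refine ⟨ε 0, hε 0, b * x - ε 0, ⟨fun i => ε (i + 1), fun i => hε _, hasSum_digits_tail hb hs⟩, ?_⟩
  field_simp
  ring

lemma hasSum_geometric_digit (hb : 1 < b) (c : ℝ) :
    HasSum (fun i : ℕ => c / b ^ (i + 1)) (c / (b - 1)) := by
  have hb0 : b ≠ 0 := by positivity
  have hb1 : b - 1 ≠ 0 := by linarith
  have h := (hasSum_geometric_of_lt_one (r := b⁻¹) (by positivity)
    (inv_lt_one_of_one_lt₀ hb)).mul_left (c / b)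
  have heq : ∀ i, c / b * b⁻¹ ^ i = c / b ^ (i + 1) := fun i => by
    rw [inv_pow]
    field_simp
    ring
  simp only [heq] at h
  have hv : c / b * (1 - b⁻¹)⁻¹ = c / (b - 1) := by
    have : 1 - b⁻¹ = (b - 1) / b := by field_simp
    rw [this]
    field_simp
  rwa [hv] at h

lemma summable_digits (hb : 1 < b) {N : ℕ} {ε : ℕ → ℕ} (hε : ∀ i, ε i ≤ N) :
    Summable (fun i => (ε i : ℝ) / b ^ (i + 1)) :=
  (hasSum_geometric_digit hb N).summable.of_nonneg_of_le (fun i => by positivity)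
    fun i => by gcongr; exact_mod_cast hε i

lemma const_mem_digitSums (hb : 1 < b) {d : ℕ} (hd : d ∈ D) : (d : ℝ) / (b - 1) ∈ digitSums b D :=
  ⟨fun _ => d, fun _ => hd, hasSum_geometric_digit hb _⟩

lemma digitSums_subset_Icc (hb : 1 < b) {N : ℕ} (hD : ∀ d ∈ D, d ≤ N) :
    digitSums b D ⊆ Icc 0 (N / (b - 1)) := by
  rintro x ⟨ε, hε, hs⟩
  refine ⟨hs.nonneg fun i => by positivity, hasSum_le (fun i => ?_) hs (hasSum_geometric_digit hb N)⟩
  gcongr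
  exact_mod_cast hD _ (hε i)

/-- The digit sequences form a compact product of finite discrete spaces, and the sum depends
continuously on the sequence because the series converges uniformly. -/
lemma isCompact_digitSums (hb : 1 < b) {N : ℕ} (hD : ∀ d ∈ D, d ≤ N) :
    IsCompact (digitSums b D) := by
  have : Finite D := (Set.finite_Iic N).subset hD
  have hsum : digitSums b D =
      range fun ε : ℕ → D => ∑' i, ((ε i : ℕ) : ℝ) / b ^ (i + 1) := by
    ext x
    constructor
    · rintro ⟨ε, hε, hs⟩
      exact ⟨fun i => ⟨ε i, hε i⟩, hs.tsum_eq⟩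
    · rintro ⟨ε, rfl⟩
      exact ⟨fun i => ε i, fun i => (ε i).2,
        (summable_digits hb fun i => hD _ (ε i).2).hasSum⟩
  rw [hsum]
  refine isCompact_range (continuous_tsum (u := fun i => (N : ℝ) / b ^ (i + 1)) (fun i => ?_)
    (hasSum_geometric_digit hb N).summable fun i ε => ?_)
  · have : Continuous fun d : D => ((d : ℕ) : ℝ) := continuous_of_discreteTopology
    exact (this.comp (continuous_apply i)).div_const _
  · rw [Real.norm_of_nonneg (by positivity)]
    gcongr
    exact_mod_cast hD _ (ε i).2

/-- A bounded set `S` with `S ⊆ ⋃ d ∈ D, (S + d) / b` consists of sums with digits in `D`. -/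
lemma subset_digitSums (hb : 1 < b) {S : Set ℝ} {M : ℝ} (hM : ∀ x ∈ S, |x| ≤ M)
    (hS : ∀ x ∈ S, ∃ d ∈ D, ∃ y ∈ S, x = (y + (d : ℕ)) / b) : S ⊆ digitSums b D := by
  have hb0 : b ≠ 0 := by positivity
  -- `f` deletes the leading digit `d`; iterating it produces the expansion, with remainder `f^[n] x
  -- / b ^ n` tending to 0 by boundedness of `S`.
  choose! d hd f hf hdf using hS
  intro x hx
  have hmem : ∀ n, f^[n] x ∈ S := fun n => by
    induction n with
    | zero => exact hx
    | succ n ih => rw [Function.iterate_succ_apply']; exact hf _ ih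
  have hpart : ∀ n, ∑ i ∈ Finset.range n, (d (f^[i] x) : ℝ) / b ^ (i + 1) =
      x - f^[n] x / b ^ n := fun n => by
    induction n with
    | zero => simp
    | succ n ih =>
      have h := hdf _ (hmem n)
      rw [Finset.sum_range_succ, ih, Function.iterate_succ_apply', sub_add, sub_right_inj]
      nth_rw 1 [h]
      field_simp
      ring
  refine ⟨fun i => d (f^[i] x), fun i => hd _ (hmem i), ?_⟩
  rw [hasSum_iff_tendsto_nat_of_nonneg fun i => by positivity]
  simp_rw [hpart]
  have h0 : Tendsto (fun n => M / b ^ n) atTop (𝓝 0) :=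
    tendsto_const_nhds.div_atTop (tendsto_pow_atTop_atTop_of_one_lt hb)
  have h1 : Tendsto (fun n => f^[n] x / b ^ n) atTop (𝓝 0) := by
    refine squeeze_zero_norm (fun n => ?_) h0
    rw [Real.norm_eq_abs, abs_div, abs_of_pos (by positivity : (0 : ℝ) < b ^ n)]
    gcongr
    exact hM _ (hmem n)
  simpa using tendsto_const_nhds.sub h1

end DigitSums

/-! ### The tiling by translates of K_l and the overlap of neighbouring translates -/

/-- The points `x` for which both `x` and `x + 1` lie in `K_l`; this is the left half of the
boundary of `K_l`. -/
def overlapSet (l : ℕ) : Set ℝ := {x | x ∈ selfSimilarK l ∧ x + 1 ∈ selfSimilarK l}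

section SelfSimilarK

variable {l : ℕ}

lemma one_lt_base (l : ℕ) : (1 : ℝ) < 2 * l + 2 := by
  have : (0 : ℝ) ≤ l := by positivity
  linarith

lemma selfSimilarK_eq_digitSums (l : ℕ) :
    selfSimilarK l = digitSums (2 * (l : ℝ) + 2) (digitSet l) := rfl

lemma digitSet_le {d : ℕ} (hd : d ∈ digitSet l) : d ≤ 4 * l + 1 := by
  obtain ⟨k, hk, rfl | rfl⟩ := hd <;> omega

lemma even_mem_selfSimilarK {k : ℕ} (hk : k ≤ l) {x : ℝ} (hx : x ∈ selfSimilarK l) :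
    (x + 2 * k) / (2 * l + 2) ∈ selfSimilarK l := by
  have := digitSums_cons (one_lt_base l) (D := digitSet l) (d := 2 * k) ⟨k, hk, Or.inl rfl⟩ hx
  push_cast at this
  exact this

lemma odd_mem_selfSimilarK {k : ℕ} (hk : k ≤ l) {x : ℝ} (hx : x ∈ selfSimilarK l) :
    (x + (2 * l + 1 + 2 * k)) / (2 * l + 2) ∈ selfSimilarK l := by
  have := digitSums_cons (one_lt_base l) (D := digitSet l) (d := 2 * l + 1 + 2 * k)
    ⟨k, hk, Or.inr rfl⟩ hx
  push_cast at this
  exact this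

lemma isCompact_selfSimilarK (l : ℕ) : IsCompact (selfSimilarK l) :=
  isCompact_digitSums (one_lt_base l) fun _ => digitSet_le

lemma selfSimilarK_bounds {x : ℝ} (hx : x ∈ selfSimilarK l) :
    0 ≤ x ∧ x ≤ 1 + 2 * l / (2 * l + 1) := by
  have h := digitSums_subset_Icc (one_lt_base l) (fun _ => digitSet_le) hx
  refine ⟨h.1, h.2.trans_eq ?_⟩
  push_cast
  have h1 : (2 * (l : ℝ) + 2 - 1) = 2 * l + 1 := by ring
  rw [h1]
  field_simp
  ring

lemma fixedPoint_lt_one (l : ℕ) : 2 * (l : ℝ) / (2 * l + 1) < 1 := by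
  rw [div_lt_one (by positivity)]
  linarith

lemma fixedPoint_nonneg (l : ℕ) : 0 ≤ 2 * (l : ℝ) / (2 * l + 1) := by positivity

lemma base_mul_fixedPoint (l : ℕ) :
    (2 * (l : ℝ) + 2) * (2 * l / (2 * l + 1)) = 2 * l / (2 * l + 1) + 2 * l := by
  field_simp
  ring

lemma const_mem_selfSimilarK {d : ℕ} (hd : d ∈ digitSet l) :
    (d : ℝ) / (2 * l + 1) ∈ selfSimilarK l := by
  have h := const_mem_digitSums (one_lt_base l) hd
  have h1 : (2 * (l : ℝ) + 2 - 1) = 2 * l + 1 := by ring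
  rwa [h1] at h

lemma zero_mem_selfSimilarK (l : ℕ) : (0 : ℝ) ∈ selfSimilarK l := by
  have h := const_mem_selfSimilarK (l := l) (d := 0) ⟨0, by omega, Or.inl rfl⟩
  simpa using h

lemma one_mem_selfSimilarK (l : ℕ) : (1 : ℝ) ∈ selfSimilarK l := by
  have h := const_mem_selfSimilarK (l := l) (d := 2 * l + 1) ⟨0, by omega, Or.inr rfl⟩
  push_cast at h
  rwa [div_self (by positivity)] at h

lemma fixedPoint_mem_selfSimilarK (l : ℕ) : 2 * (l : ℝ) / (2 * l + 1) ∈ selfSimilarK l := by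
  have h := const_mem_selfSimilarK (l := l) (d := 2 * l) ⟨l, le_rfl, Or.inl rfl⟩
  push_cast at h
  exact h

lemma fixedPoint_add_one_mem_selfSimilarK (l : ℕ) :
    2 * (l : ℝ) / (2 * l + 1) + 1 ∈ selfSimilarK l := by
  have h := const_mem_selfSimilarK (l := l) (d := 2 * l + 1 + 2 * l) ⟨l, le_rfl, Or.inr rfl⟩
  push_cast at h
  convert h using 1
  field_simp
  ring

lemma zero_mem_overlapSet (l : ℕ) : (0 : ℝ) ∈ overlapSet l :=
  ⟨zero_mem_selfSimilarK l, by simpa using one_mem_selfSimilarK l⟩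

lemma fixedPoint_mem_overlapSet (l : ℕ) : 2 * (l : ℝ) / (2 * l + 1) ∈ overlapSet l :=
  ⟨fixedPoint_mem_selfSimilarK l, fixedPoint_add_one_mem_selfSimilarK l⟩

lemma overlapSet_bounds {x : ℝ} (hx : x ∈ overlapSet l) :
    0 ≤ x ∧ x ≤ 2 * l / (2 * l + 1) :=
  ⟨(selfSimilarK_bounds hx.1).1, by linarith [(selfSimilarK_bounds hx.2).2]⟩

lemma isCompact_overlapSet (l : ℕ) : IsCompact (overlapSet l) :=
  (isCompact_selfSimilarK l).inter_right
    ((isCompact_selfSimilarK l).isClosed.preimage (continuous_add_const 1))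

/-- The digits form a complete residue system modulo `2l+2`. -/
lemma exists_digit_residue (l : ℕ) (n : ℤ) :
    ∃ d ∈ digitSet l, ∃ m : ℤ, n = d + (2 * l + 2) * m := by
  have hb : (0 : ℤ) < 2 * l + 2 := by positivity
  have h1 := Int.emod_nonneg n hb.ne'
  have h2 := Int.emod_lt_of_pos n hb
  have h3 := Int.emod_add_mul_ediv n (2 * l + 2)
  obtain ⟨r, hr⟩ := Int.eq_ofNat_of_zero_le h1
  obtain ⟨k, rfl | rfl⟩ := Nat.even_or_odd' r
  · exact ⟨2 * k, ⟨k, by omega, Or.inl rfl⟩, n / (2 * l + 2), by rw [← hr, h3]⟩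
  -- An odd residue below 2l+1 is not itself a digit; adding 2l+2 makes it one, at the cost of
  -- lowering the quotient by 1.
  · by_cases hk : k = l
    · exact ⟨2 * l + 1, ⟨0, by omega, Or.inr rfl⟩, n / (2 * l + 2), by
        subst hk; rw [← hr, h3]⟩
    · refine ⟨2 * l + 1 + 2 * (k + 1), ⟨k + 1, by omega, Or.inr rfl⟩, n / (2 * l + 2) - 1, ?_⟩
      rw [mul_sub]
      push_cast at hr ⊢
      linarith

/-- The integer translates of `K_l` cover the line. -/
lemma exists_int_sub_mem_selfSimilarK (l : ℕ) (x : ℝ) : ∃ n : ℤ, x - n ∈ selfSimilarK l := by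
  set T : Set ℝ := {x | ∃ n : ℤ, x - n ∈ selfSimilarK l}
  have hb := one_lt_base l
  have hT : IsClosed T := by
    have : T = selfSimilarK l + range ((↑) : ℤ → ℝ) := by
      ext x
      simp only [T, mem_ofPred_eq, Set.mem_add, mem_range, exists_exists_eq_and]
      exact ⟨fun ⟨n, h⟩ => ⟨_, h, n, by ring⟩, fun ⟨y, hy, n, h⟩ => ⟨n, by rwa [← h, add_sub_cancel_right]⟩⟩
    rw [this]
    exact Int.isClosedEmbedding_coe_real.isClosed_range.add_left_of_isCompact
      (isCompact_selfSimilarK l)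
  -- All fractions with denominator a power of 2l+2 lie in `T`: the residue digit of `k` is
  -- prepended to the expansion and the quotient becomes the new translation. These fractions are
  -- dense and `T` is closed.
  have hdiv : ∀ n : ℕ, ∀ m : ℤ, (m : ℝ) / (2 * l + 2) ^ n ∈ T := by
    intro n
    induction n with
    | zero => exact fun m => ⟨m, by simpa using zero_mem_selfSimilarK l⟩
    | succ n ih =>
      intro m
      obtain ⟨k, hk⟩ := ih m
      obtain ⟨d, hd, j, rfl⟩ := exists_digit_residue l k
      refine ⟨j, ?_⟩
      have := digitSums_cons hb hd hk
      rw [← selfSimilarK_eq_digitSums] at this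
      convert this using 1
      push_cast
      field_simp
      ring
  have hlim : Tendsto (fun n : ℕ => (⌊x * (2 * l + 2) ^ n⌋ : ℝ) / (2 * l + 2) ^ n) atTop (𝓝 x) := by
    have h0 : Tendsto (fun n : ℕ => 1 / (2 * (l : ℝ) + 2) ^ n) atTop (𝓝 0) :=
      tendsto_const_nhds.div_atTop (tendsto_pow_atTop_atTop_of_one_lt hb)
    rw [tendsto_iff_dist_tendsto_zero]
    refine squeeze_zero (fun n => dist_nonneg) (fun n => ?_) h0
    have hpow : (0 : ℝ) < (2 * (l : ℝ) + 2) ^ n := by positivity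
    rw [Real.dist_eq, abs_sub_comm, abs_le]
    have h1 := Int.floor_le (x * (2 * (l : ℝ) + 2) ^ n)
    have h2 := Int.lt_floor_add_one (x * (2 * (l : ℝ) + 2) ^ n)
    have h3 : x - ⌊x * (2 * (l : ℝ) + 2) ^ n⌋ / (2 * (l : ℝ) + 2) ^ n =
        (x * (2 * (l : ℝ) + 2) ^ n - ⌊x * (2 * (l : ℝ) + 2) ^ n⌋) / (2 * (l : ℝ) + 2) ^ n := by
      field_simp
    rw [h3]
    constructor
    · have : 0 ≤ 1 / (2 * (l : ℝ) + 2) ^ n := by positivity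
      have : 0 ≤ (x * (2 * (l : ℝ) + 2) ^ n - ⌊x * (2 * (l : ℝ) + 2) ^ n⌋) / (2 * (l : ℝ) + 2) ^ n :=
        div_nonneg (by linarith) hpow.le
      linarith
    · gcongr
      linarith
  exact hT.mem_of_tendsto hlim (Eventually.of_forall fun n => hdiv n _)

lemma mem_or_add_one_mem_selfSimilarK {x : ℝ} (h0 : 0 ≤ x) (h1 : x < 1) :
    x ∈ selfSimilarK l ∨ x + 1 ∈ selfSimilarK l := by
  obtain ⟨n, hn⟩ := exists_int_sub_mem_selfSimilarK l x
  have hb := selfSimilarK_bounds hn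
  have := fixedPoint_lt_one l
  have hn1 : (n : ℝ) < 1 := by linarith
  have hn2 : (-2 : ℝ) < n := by linarith
  norm_cast at hn1 hn2
  obtain rfl | rfl : n = 0 ∨ n = -1 := by
    have : -2 < n := by exact_mod_cast hn2
    omega
  · left; simpa using hn
  · right; simpa using hn

lemma Ioo_subset_selfSimilarK (l : ℕ) : Ioo (2 * (l : ℝ) / (2 * l + 1)) 1 ⊆ selfSimilarK l := by
  rintro x ⟨h0, h1⟩
  have := fixedPoint_nonneg l
  refine (mem_or_add_one_mem_selfSimilarK (by linarith) h1).resolve_right fun h => ?_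
  linarith [(selfSimilarK_bounds h).2]

/-- Adding 1 to the quotient adds 2l+2 to the numerator, and 2k + 2l+2 = (2l+1+2k) + 1 hands one
unit back to `x`. So an even leading digit preserves the memberships of `x` and `x + 1`; the next
two lemmas show that an odd one exchanges them. -/
lemma div_mem_of_mem_even {k : ℕ} (hk : k ≤ l) {x : ℝ} (hx : x + 1 ∈ selfSimilarK l) :
    (x + 2 * k) / (2 * l + 2) + 1 ∈ selfSimilarK l := by
  convert odd_mem_selfSimilarK hk hx using 1
  field_simp
  ring

lemma div_add_one_mem_of_mem_odd {k : ℕ} (hk : k < l) {x : ℝ} (hx : x ∈ selfSimilarK l) :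
    (x + (2 * k + 1)) / (2 * l + 2) + 1 ∈ selfSimilarK l := by
  convert odd_mem_selfSimilarK (k := k + 1) hk hx using 1
  push_cast
  field_simp
  ring

lemma div_mem_of_add_one_mem_odd {k : ℕ} (hk : k < l) {x : ℝ} (hx : x + 1 ∈ selfSimilarK l) :
    (x + (2 * k + 1)) / (2 * l + 2) ∈ selfSimilarK l := by
  convert even_mem_selfSimilarK hk.le hx using 1
  ring

lemma overlapSet_cons {j : ℕ} (hj : j ≤ 2 * l) {x : ℝ} (hx : x ∈ overlapSet l) :
    (x + j) / (2 * l + 2) ∈ overlapSet l := by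
  obtain ⟨k, rfl | rfl⟩ := Nat.even_or_odd' j
  · push_cast
    exact ⟨even_mem_selfSimilarK (by omega) hx.1, div_mem_of_mem_even (by omega) hx.2⟩
  · push_cast
    exact ⟨div_mem_of_add_one_mem_odd (by omega) hx.2, div_add_one_mem_of_mem_odd (by omega) hx.1⟩

/-- If d, d' are first digits of x, x + 1, the tails differ by the integer 2l+2+d-d', which has
absolute value below 2. The shape of the digit set rules out 0. Difference 1 gives the even digit j
= d, difference -1 the odd digit j = d + 1. -/
lemma overlapSet_uncons {x : ℝ} (hx : x ∈ overlapSet l) :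
    ∃ j ≤ 2 * l, ∃ y ∈ overlapSet l, x = (y + (j : ℕ)) / (2 * l + 2) := by
  obtain ⟨d, hd, y, hy, hxy⟩ := digitSums_uncons (one_lt_base l) hx.1
  obtain ⟨d', hd', y', hy', hxy'⟩ := digitSums_uncons (one_lt_base l) hx.2
  have hp := fixedPoint_lt_one l
  have hby := selfSimilarK_bounds hy
  have hby' := selfSimilarK_bounds hy'
  have heq : y' = y + (2 * l + 2 + d - d') := by
    rw [hxy] at hxy'
    field_simp at hxy'
    linarith
  have h1 : ((2 * l + 2 + d - d' : ℤ) : ℝ) < 2 := by push_cast; linarith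
  have h2 : (-2 : ℝ) < ((2 * l + 2 + d - d' : ℤ) : ℝ) := by push_cast; linarith
  have h1' : (2 * l + 2 + d - d' : ℤ) < 2 := by exact_mod_cast h1
  have h2' : -2 < (2 * l + 2 + d - d' : ℤ) := by exact_mod_cast h2
  obtain ⟨k, hk, hdk⟩ := hd
  obtain ⟨k', hk', hdk'⟩ := hd'
  obtain h | h : d = 2 * k ∧ d' = d + 2 * l + 1 ∨ d = 2 * k ∧ k < l ∧ d' = d + 2 * l + 3 := by omega
  · obtain ⟨rfl, rfl⟩ := h
    refine ⟨2 * k, by omega, y, ⟨hy, ?_⟩, hxy⟩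
    rw [← selfSimilarK_eq_digitSums] at hy'
    convert hy' using 1
    rw [heq]
    push_cast
    ring
  · obtain ⟨rfl, hkl, rfl⟩ := h
    have hy2 : y = y' + 1 := by
      rw [heq]
      push_cast
      ring
    refine ⟨2 * k + 1, by omega, y', ⟨hy', hy2 ▸ hy⟩, ?_⟩
    rw [hxy, hy2]
    push_cast
    ring

lemma overlapSet_div_inj {i j : ℕ} {x y : ℝ} (hx : 0 ≤ x ∧ x < 1) (hy : 0 ≤ y ∧ y < 1)
    (h : (x + i) / (2 * l + 2) = (y + j) / (2 * (l : ℝ) + 2)) : i = j ∧ x = y := by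
  have hb := one_lt_base l
  rw [div_left_inj' (by linarith)] at h
  have h1 : (i : ℝ) < j + 1 := by linarith
  have h2 : (j : ℝ) < i + 1 := by linarith
  norm_cast at h1 h2
  obtain rfl : i = j := by omega
  exact ⟨rfl, by linarith⟩

/-- Near every point of the overlap set there are gaps of this set of both kinds. -/
lemma exists_gaps_overlapSet (hl : 1 ≤ l) (n : ℕ) : ∀ x ∈ overlapSet l,
    (∃ a ∈ overlapSet l, ∃ b ∈ overlapSet l, a < b ∧ |a - x| ≤ 1 / (2 * l + 2) ^ n ∧
      |b - x| ≤ 1 / (2 * l + 2) ^ n ∧ Disjoint (Ioo a b) (overlapSet l) ∧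
      ∀ y ∈ Ioo a b, y ∈ selfSimilarK l) ∧
    ∃ a ∈ overlapSet l, ∃ b ∈ overlapSet l, a < b ∧ |a - x| ≤ 1 / (2 * l + 2) ^ n ∧
      |b - x| ≤ 1 / (2 * l + 2) ^ n ∧ Disjoint (Ioo a b) (overlapSet l) ∧
      ∀ y ∈ Ioo a b, y + 1 ∈ selfSimilarK l := by
  have hb := one_lt_base l
  have hb0 : (0 : ℝ) < 2 * l + 2 := by linarith
  have hp := fixedPoint_lt_one l
  have hp0 := fixedPoint_nonneg l
  induction n with
  | zero =>
    intro x hx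
    have hclose : ∀ a ∈ overlapSet l, |a - x| ≤ 1 / (2 * (l : ℝ) + 2) ^ 0 := fun a ha => by
      have h1 := overlapSet_bounds hx
      have h2 := overlapSet_bounds ha
      rw [pow_zero, div_one, abs_le]
      constructor <;> linarith
    -- The gap between the pieces of digits j and j+1 is the image of (p, 1), p = 2l/(2l+1), which
    -- lies in K_l. Below, j = 0 gives a gap in K_l and j = 1 one in K_l - 1; the second needs the
    -- digit 2 ≤ 2l.
    have hgap : ∀ j : ℕ, j + 1 ≤ 2 * l → ∀ y ∈ Ioo ((2 * (l : ℝ) / (2 * l + 1) + j) / (2 * l + 2))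
        ((0 + (j + 1 : ℕ)) / (2 * l + 2)), y ∉ overlapSet l ∧
        ∃ z ∈ Ioo (2 * (l : ℝ) / (2 * l + 1)) 1, y = (z + j) / (2 * l + 2) := by
      rintro j hj y ⟨hy1, hy2⟩
      rw [div_lt_iff₀ hb0] at hy1
      rw [lt_div_iff₀ hb0] at hy2
      push_cast at hy2
      refine ⟨fun hy => ?_, y * (2 * l + 2) - j, ⟨by linarith, by linarith⟩, by field_simp; ring⟩
      obtain ⟨i, hi, z, hz, rfl⟩ := overlapSet_uncons hy
      have hz' := overlapSet_bounds hz
      rw [div_mul_cancel₀ _ hb0.ne'] at hy1 hy2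
      have h1 : (i : ℝ) < j + 1 := by linarith
      have h2 : (j : ℝ) < i + 1 := by linarith
      norm_cast at h1 h2
      obtain rfl : i = j := by omega
      linarith
    have hlt : ∀ j : ℕ, (2 * (l : ℝ) / (2 * l + 1) + j) / (2 * l + 2) <
        (0 + (j + 1 : ℕ)) / (2 * l + 2) := fun j => by
      rw [div_lt_div_iff_of_pos_right hb0]
      push_cast
      linarith
    have hleft : ∀ j : ℕ, j ≤ 2 * l → (2 * (l : ℝ) / (2 * l + 1) + j) / (2 * l + 2) ∈ overlapSet l :=
      fun j hj => overlapSet_cons hj (fixedPoint_mem_overlapSet l)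
    have hright : ∀ j : ℕ, j ≤ 2 * l → (0 + (j : ℝ)) / (2 * l + 2) ∈ overlapSet l :=
      fun j hj => overlapSet_cons hj (zero_mem_overlapSet l)
    refine ⟨⟨_, hleft 0 (by omega), _, hright (0 + 1) (by omega), hlt 0, hclose _ (hleft _ (by omega)),
      hclose _ (hright _ (by omega)), disjoint_left.2 fun y hy => (hgap 0 (by omega) y hy).1,
      fun y hy => ?_⟩,
      ⟨_, hleft 1 (by omega), _, hright (1 + 1) (by omega), hlt 1, hclose _ (hleft _ (by omega)),
      hclose _ (hright _ (by omega)), disjoint_left.2 fun y hy => (hgap 1 (by omega) y hy).1,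
      fun y hy => ?_⟩⟩
    · obtain ⟨z, hz, rfl⟩ := (hgap 0 (by omega) y hy).2
      simpa using even_mem_selfSimilarK (k := 0) (by omega) (Ioo_subset_selfSimilarK l hz)
    · obtain ⟨z, hz, rfl⟩ := (hgap 1 (by omega) y hy).2
      simpa using div_add_one_mem_of_mem_odd (k := 0) hl (Ioo_subset_selfSimilarK l hz)
  | succ n ih =>
    intro x hx
    obtain ⟨j, hj, x, hx', rfl⟩ := overlapSet_uncons hx
    have hclose : ∀ a, |a - x| ≤ 1 / (2 * (l : ℝ) + 2) ^ n →
        |(a + j) / (2 * l + 2) - (x + j) / (2 * l + 2)| ≤ 1 / (2 * (l : ℝ) + 2) ^ (n + 1) := by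
      intro a ha
      rw [← sub_div, abs_div, abs_of_pos hb0, pow_succ, ← div_div]
      rw [add_sub_add_right_eq_sub]
      gcongr
    have key : ∀ S T : Set ℝ, (∀ y ∈ S, (y + j) / (2 * l + 2) ∈ T) →
        (∃ a ∈ overlapSet l, ∃ b ∈ overlapSet l, a < b ∧ |a - x| ≤ 1 / (2 * l + 2) ^ n ∧
          |b - x| ≤ 1 / (2 * l + 2) ^ n ∧ Disjoint (Ioo a b) (overlapSet l) ∧
          ∀ y ∈ Ioo a b, y ∈ S) →
        ∃ a ∈ overlapSet l, ∃ b ∈ overlapSet l, a < b ∧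
          |a - (x + j) / (2 * l + 2)| ≤ 1 / (2 * l + 2) ^ (n + 1) ∧
          |b - (x + j) / (2 * l + 2)| ≤ 1 / (2 * l + 2) ^ (n + 1) ∧
          Disjoint (Ioo a b) (overlapSet l) ∧ ∀ y ∈ Ioo a b, y ∈ T := by
      rintro S T hST ⟨a, ha, c, hc, hac, hax, hcx, hdis, hS⟩
      have hpre : ∀ y ∈ Ioo ((a + j) / (2 * (l : ℝ) + 2)) ((c + j) / (2 * l + 2)),
          ∃ z ∈ Ioo a c, y = (z + j) / (2 * l + 2) := by
        rintro y ⟨hy1, hy2⟩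
        rw [div_lt_iff₀ hb0] at hy1
        rw [lt_div_iff₀ hb0] at hy2
        exact ⟨y * (2 * l + 2) - j, ⟨by linarith, by linarith⟩, by field_simp; ring⟩
      refine ⟨_, overlapSet_cons hj ha, _, overlapSet_cons hj hc, by gcongr, hclose a hax,
        hclose c hcx, disjoint_left.2 fun y hy hyA => ?_, fun y hy => ?_⟩
      · obtain ⟨z, hz, rfl⟩ := hpre y hy
        obtain ⟨i, hi, w, hw, hzw⟩ := overlapSet_uncons hyA
        have hw' := overlapSet_bounds hw
        have ha' := overlapSet_bounds ha
        have hc' := overlapSet_bounds hc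
        obtain ⟨-, rfl⟩ := overlapSet_div_inj ⟨by linarith [hz.1], by linarith [hz.2]⟩
          ⟨hw'.1, by linarith⟩ hzw
        exact disjoint_left.1 hdis hz hw
      · obtain ⟨z, hz, rfl⟩ := hpre y hy
        exact hST _ (hS z hz)
    obtain ⟨h1, h2⟩ := ih x hx'
    -- Shrinking by an even digit keeps the kind of a gap, by an odd digit it swaps the kinds, so
    -- the two induction hypotheses are used crosswise in the odd case.
    obtain ⟨k, hk⟩ := Nat.even_or_odd' j
    obtain rfl | rfl := hk
    · refine ⟨key _ (selfSimilarK l) (fun y hy => ?_) h1,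
        key {y | y + 1 ∈ selfSimilarK l} {y | y + 1 ∈ selfSimilarK l} (fun y hy => ?_) h2⟩
      · push_cast
        exact even_mem_selfSimilarK (by omega) hy
      · push_cast
        exact div_mem_of_mem_even (by omega) hy
    · refine ⟨key {y | y + 1 ∈ selfSimilarK l} (selfSimilarK l) (fun y hy => ?_) h2,
        key (selfSimilarK l) {y | y + 1 ∈ selfSimilarK l} (fun y hy => ?_) h1⟩
      · push_cast
        exact div_mem_of_add_one_mem_odd (by omega) hy
      · push_cast
        exact div_add_one_mem_of_mem_odd (by omega) hy

end SelfSimilarK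

/-! ### The boundary and the measure of K_l -/

section Frontier

variable {l : ℕ}

lemma exists_gaps_overlapSet_lt (hl : 1 ≤ l) {x ε : ℝ} (hx : x ∈ overlapSet l) (hε : 0 < ε) :
    (∃ a ∈ overlapSet l, ∃ b ∈ overlapSet l, a < b ∧ |a - x| < ε ∧ |b - x| < ε ∧
      Disjoint (Ioo a b) (overlapSet l) ∧ ∀ y ∈ Ioo a b, y ∈ selfSimilarK l) ∧
    ∃ a ∈ overlapSet l, ∃ b ∈ overlapSet l, a < b ∧ |a - x| < ε ∧ |b - x| < ε ∧
      Disjoint (Ioo a b) (overlapSet l) ∧ ∀ y ∈ Ioo a b, y + 1 ∈ selfSimilarK l := by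
  have h0 : Tendsto (fun n : ℕ => 1 / (2 * (l : ℝ) + 2) ^ n) atTop (𝓝 0) :=
    tendsto_const_nhds.div_atTop (tendsto_pow_atTop_atTop_of_one_lt (one_lt_base l))
  obtain ⟨n, hn⟩ := (h0.eventually_lt_const hε).exists
  obtain ⟨⟨a, ha, b, hb, hab, h1, h2, h3⟩, c, hc, d, hd, hcd, h4, h5, h6⟩ :=
    exists_gaps_overlapSet hl n x hx
  exact ⟨⟨a, ha, b, hb, hab, h1.trans_lt hn, h2.trans_lt hn, h3⟩,
    c, hc, d, hd, hcd, h4.trans_lt hn, h5.trans_lt hn, h6⟩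

/-- A point near the hull of `K_l` lies in `K_l` or in one of the translates `K_l - 1`, `K_l + 1`. -/
lemma mem_of_add_notMem_of_sub_notMem {y : ℝ} (h2 : y < 2)
    (hy1 : y + 1 ∉ selfSimilarK l) (hy2 : y - 1 ∉ selfSimilarK l)
    (h3 : 2 * (l : ℝ) / (2 * l + 1) - 1 < y) : y ∈ selfSimilarK l := by
  obtain ⟨n, hn⟩ := exists_int_sub_mem_selfSimilarK l y
  have hb := selfSimilarK_bounds hn
  have hn1 : (n : ℝ) < 2 := by linarith
  have hn2 : (-2 : ℝ) < n := by linarith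
  have hn1' : n < 2 := by exact_mod_cast hn1
  have hn2' : -2 < n := by exact_mod_cast hn2
  obtain rfl | rfl | rfl : n = 0 ∨ n = -1 ∨ n = 1 := by omega
  · simpa using hn
  · exact absurd (by simpa using hn) hy1
  · exact absurd (by simpa using hn) hy2

/-- A point of K_l outside both neighbouring translates has a neighbourhood missing them, which the
tiling forces into K_l. Conversely, gaps of the kind not in K_l accumulate at each point of the
overlap, and likewise after translation by 1. -/
lemma frontier_selfSimilarK (hl : 1 ≤ l) :
    frontier (selfSimilarK l) = overlapSet l ∪ (· + 1) '' overlapSet l := by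
  have hcl := (isCompact_selfSimilarK l).isClosed
  have hp := fixedPoint_lt_one l
  have hp0 := fixedPoint_nonneg l
  rw [hcl.frontier_eq]
  apply Subset.antisymm
  · rintro x ⟨hx, hxi⟩
    by_contra hcon
    rw [mem_union, not_or] at hcon
    have hx1 : x + 1 ∉ selfSimilarK l := fun h => hcon.1 ⟨hx, h⟩
    have hx2 : x - 1 ∉ selfSimilarK l := fun h =>
      hcon.2 ⟨x - 1, ⟨h, by simpa using hx⟩, by simp⟩
    have hb := selfSimilarK_bounds hx
    apply hxi
    rw [mem_interior_iff_mem_nhds]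
    have e1 : ∀ᶠ y in 𝓝 x, y + 1 ∉ selfSimilarK l :=
      (continuous_add_const (1 : ℝ)).continuousAt.eventually (hcl.isOpen_compl.mem_nhds hx1)
    have e2 : ∀ᶠ y in 𝓝 x, y - 1 ∉ selfSimilarK l :=
      (continuous_sub_right (1 : ℝ)).continuousAt.eventually (hcl.isOpen_compl.mem_nhds hx2)
    filter_upwards [e1, e2, lt_mem_nhds (show 2 * (l : ℝ) / (2 * l + 1) - 1 < x by linarith),
      gt_mem_nhds (show x < 2 by linarith)] with y hy1 hy2 hy3 hy4
    exact mem_of_add_notMem_of_sub_notMem hy4 hy1 hy2 hy3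
  · have key : ∀ x ∈ selfSimilarK l, (∀ ε > 0, ∃ y ∉ selfSimilarK l, |y - x| < ε) →
        x ∈ selfSimilarK l \ interior (selfSimilarK l) := fun x hx h => by
      refine ⟨hx, fun hxi => ?_⟩
      rw [mem_interior_iff_mem_nhds, Metric.mem_nhds_iff] at hxi
      obtain ⟨ε, hε, hsub⟩ := hxi
      obtain ⟨y, hy, hyx⟩ := h ε hε
      exact hy (hsub hyx)
    rintro _ (hx | ⟨x, hx, rfl⟩)
    · refine key _ hx.1 fun ε hε => ?_
      obtain ⟨-, a, -, b, -, hab, ha, hb, hdis, hK⟩ := exists_gaps_overlapSet_lt hl hx hε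
      have hm : (a + b) / 2 ∈ Ioo a b := ⟨by linarith, by linarith⟩
      refine ⟨_, fun h => disjoint_left.1 hdis hm ⟨h, hK _ hm⟩, ?_⟩
      rw [abs_lt] at *
      constructor <;> linarith
    · refine key _ hx.2 fun ε hε => ?_
      obtain ⟨⟨a, -, b, -, hab, ha, hb, hdis, hK⟩, -⟩ := exists_gaps_overlapSet_lt hl hx hε
      have hm : (a + b) / 2 ∈ Ioo a b := ⟨by linarith, by linarith⟩
      refine ⟨(a + b) / 2 + 1, fun h => disjoint_left.1 hdis hm ⟨hK _ hm, h⟩, ?_⟩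
      rw [abs_lt] at *
      constructor <;> linarith

/-- Near every boundary point of `K_l` there are gaps of the boundary inside and outside `K_l`. -/
lemma exists_gaps_frontier (hl : 1 ≤ l) {x ε : ℝ} (hx : x ∈ frontier (selfSimilarK l))
    (hε : 0 < ε) :
    (∃ a ∈ frontier (selfSimilarK l), ∃ b ∈ frontier (selfSimilarK l), a < b ∧ |a - x| < ε ∧
      |b - x| < ε ∧ Disjoint (Ioo a b) (frontier (selfSimilarK l)) ∧ Ioo a b ⊆ selfSimilarK l) ∧
    ∃ a ∈ frontier (selfSimilarK l), ∃ b ∈ frontier (selfSimilarK l), a < b ∧ |a - x| < ε ∧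
      |b - x| < ε ∧ Disjoint (Ioo a b) (frontier (selfSimilarK l)) ∧
      Disjoint (Ioo a b) (selfSimilarK l) := by
  have hp := fixedPoint_lt_one l
  rw [frontier_selfSimilarK hl] at hx ⊢
  have hleft : ∀ {a b : ℝ}, a ∈ overlapSet l → b ∈ overlapSet l →
      Disjoint (Ioo a b) (overlapSet l) →
      Disjoint (Ioo a b) (overlapSet l ∪ (· + 1) '' overlapSet l) := by
    intro a b ha hb hdis
    refine disjoint_union_right.2 ⟨hdis, disjoint_left.2 ?_⟩
    rintro _ hy ⟨y, hyA, rfl⟩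
    linarith [hy.2, overlapSet_bounds hb, overlapSet_bounds hyA]
  have hright : ∀ {a b : ℝ}, a ∈ overlapSet l → b ∈ overlapSet l →
      Disjoint (Ioo a b) (overlapSet l) →
      Disjoint (Ioo (a + 1) (b + 1)) (overlapSet l ∪ (· + 1) '' overlapSet l) := by
    intro a b ha hb hdis
    refine disjoint_union_right.2 ⟨disjoint_left.2 fun y hy hyA => ?_, disjoint_left.2 ?_⟩
    · linarith [hy.1, overlapSet_bounds ha, overlapSet_bounds hyA]
    · rintro _ hy ⟨y, hyA, rfl⟩
      exact disjoint_left.1 hdis ⟨by linarith [hy.1], by linarith [hy.2]⟩ hyA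
  obtain hx | ⟨x, hx, rfl⟩ := hx
  · obtain ⟨⟨a, ha, b, hb, hab, hax, hbx, hdis, hK⟩, c, hc, d, hd, hcd, hcx, hdx, hdis', hK'⟩ :=
      exists_gaps_overlapSet_lt hl hx hε
    exact ⟨⟨a, Or.inl ha, b, Or.inl hb, hab, hax, hbx, hleft ha hb hdis, hK⟩,
      c, Or.inl hc, d, Or.inl hd, hcd, hcx, hdx, hleft hc hd hdis',
      disjoint_left.2 fun y hy hyK => disjoint_left.1 hdis' hy ⟨hyK, hK' y hy⟩⟩
  · obtain ⟨⟨a, ha, b, hb, hab, hax, hbx, hdis, hK⟩, c, hc, d, hd, hcd, hcx, hdx, hdis', hK'⟩ :=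
      exists_gaps_overlapSet_lt hl hx hε
    have hsub : ∀ {a b y : ℝ}, y ∈ Ioo (a + 1) (b + 1) → y - 1 ∈ Ioo a b := fun hy =>
      ⟨by linarith [hy.1], by linarith [hy.2]⟩
    -- Translation by 1 exchanges the kinds: a gap inside K_l - 1 moves into K_l, and one inside K_l
    -- but off the overlap moves out of it.
    refine ⟨⟨c + 1, Or.inr ⟨c, hc, rfl⟩, d + 1, Or.inr ⟨d, hd, rfl⟩, by linarith, by simpa, by simpa,
      hright hc hd hdis', fun y hy => by simpa using hK' _ (hsub hy)⟩,
      a + 1, Or.inr ⟨a, ha, rfl⟩, b + 1, Or.inr ⟨b, hb, rfl⟩, by linarith, by simpa, by simpa,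
      hright ha hb hdis, disjoint_left.2 fun y hy hyK =>
        disjoint_left.1 hdis (hsub hy) ⟨hK _ (hsub hy), by simpa using hyK⟩⟩

/-- Cut K_l at 1 and shift the upper part down by 1: the two parts cover [0, 1) and meet only inside
the overlap. -/
lemma volume_selfSimilarK (h0 : volume (overlapSet l) = 0) : volume (selfSimilarK l) = 1 := by
  have hp := fixedPoint_lt_one l
  have hmeas : MeasurableSet (selfSimilarK l) := (isCompact_selfSimilarK l).isClosed.measurableSet
  set U := selfSimilarK l ∩ Iio 1
  set V := (· + 1) ⁻¹' (selfSimilarK l \ Iio 1)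
  have hV : MeasurableSet V := (hmeas.diff measurableSet_Iio).preimage (measurable_add_const 1)
  have hUV : U ∪ V = Ico 0 1 := by
    ext x
    constructor
    · rintro (⟨hx, hx1⟩ | ⟨hx, hx1⟩)
      · exact ⟨(selfSimilarK_bounds hx).1, hx1⟩
      · simp only [mem_Iio, not_lt] at hx1
        exact ⟨by linarith, by linarith [(selfSimilarK_bounds hx).2]⟩
    · rintro ⟨hx, hx1⟩
      rcases mem_or_add_one_mem_selfSimilarK hx hx1 with h | h
      · exact Or.inl ⟨h, hx1⟩
      · exact Or.inr ⟨h, by simpa using hx⟩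
  have hdis : AEDisjoint volume U V :=
    measure_mono_null (show U ∩ V ⊆ overlapSet l from fun x hx => ⟨hx.1.1, hx.2.1⟩) h0
  calc volume (selfSimilarK l)
      = volume U + volume (selfSimilarK l \ Iio 1) := (measure_inter_add_sdiff _ measurableSet_Iio).symm
    _ = volume U + volume V := by rw [measure_preimage_add_right]
    _ = volume (U ∪ V) := (measure_union₀ hV.nullMeasurableSet hdis).symm
    _ = 1 := by rw [hUV, Real.volume_Ico]; simp

end Frontier

/-! ### Hausdorff dimension of the boundary -/

section Dimension

/-- A nonempty closed set that is mapped into itself by all `x ↦ (x + d) / b` with `d ∈ D` contains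
all sums with digits in `D`. -/
lemma digitSums_subset {b : ℝ} (hb : 1 < b) {D : Set ℕ} {N : ℕ} (hD : ∀ d ∈ D, d ≤ N) {S : Set ℝ}
    (hS : IsClosed S) (hne : S.Nonempty) (hcons : ∀ d ∈ D, ∀ x ∈ S, (x + (d : ℕ)) / b ∈ S) :
    digitSums b D ⊆ S := by
  obtain ⟨s, hs⟩ := hne
  -- Prepending a common digit divides distances by `b`, so sums with digits in `D` are approximated
  -- by points of `S` at a geometric rate.
  have happrox : ∀ n : ℕ, ∀ x ∈ digitSums b D, ∃ y ∈ S, |x - y| ≤ (N / (b - 1) + |s|) / b ^ n := by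
    intro n
    induction n with
    | zero =>
      intro x hx
      have h := digitSums_subset_Icc hb hD hx
      refine ⟨s, hs, ?_⟩
      rw [pow_zero, div_one]
      refine (abs_sub _ _).trans ?_
      rw [abs_of_nonneg h.1]
      linarith [h.2]
    | succ n ih =>
      intro x hx
      obtain ⟨d, hd, x, hx', rfl⟩ := digitSums_uncons hb hx
      obtain ⟨y, hy, hxy⟩ := ih x hx'
      refine ⟨_, hcons d hd y hy, ?_⟩
      rw [← sub_div, add_sub_add_right_eq_sub, abs_div, abs_of_pos (by linarith : 0 < b), pow_succ,
        ← div_div]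
      gcongr
  intro x hx
  choose y hy hxy using fun n => happrox n x hx
  have h0 : Tendsto (fun n => (N / (b - 1) + |s|) / b ^ n) atTop (𝓝 0) :=
    tendsto_const_nhds.div_atTop (tendsto_pow_atTop_atTop_of_one_lt hb)
  refine hS.mem_of_tendsto (b := atTop) (f := y) ?_ (Eventually.of_forall hy)
  rw [tendsto_iff_dist_tendsto_zero]
  exact squeeze_zero (fun _ => dist_nonneg) (fun n => by rw [dist_comm]; exact hxy n) h0

lemma overlapSet_eq_digitSums (l : ℕ) :
    overlapSet l = digitSums (2 * (l : ℝ) + 2) (Iic (2 * l)) := by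
  apply Subset.antisymm
  · refine subset_digitSums (one_lt_base l) (M := 1) (fun x hx => ?_) fun x hx => overlapSet_uncons hx
    have h := overlapSet_bounds hx
    rw [abs_of_nonneg h.1]
    linarith [fixedPoint_lt_one l]
  · exact digitSums_subset (one_lt_base l) (fun _ h => h) (isCompact_overlapSet l).isClosed
      ⟨0, zero_mem_overlapSet l⟩ fun d hd x hx => overlapSet_cons hd hx

/-- The greedy expansion: the digit is the integer part of (m+1)x, and the fractional part stays in
[0, 1). -/
lemma Ico_subset_digitSums {m : ℕ} (hm : 1 ≤ m) :
    Ico 0 1 ⊆ digitSums ((m : ℝ) + 1) (Iic m) := by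
  have hm' : (1 : ℝ) ≤ m := by exact_mod_cast hm
  refine subset_digitSums (by linarith) (M := 1) (fun x hx => ?_) fun x hx => ?_
  · rw [abs_of_nonneg hx.1]
    exact hx.2.le
  · have h0 : 0 ≤ ((m : ℝ) + 1) * x := mul_nonneg (by linarith) hx.1
    refine ⟨⌊((m : ℝ) + 1) * x⌋₊, ?_, ((m : ℝ) + 1) * x - ⌊((m : ℝ) + 1) * x⌋₊, ⟨?_, ?_⟩, ?_⟩
    · rw [mem_Iic, ← Nat.lt_succ_iff, Nat.floor_lt h0]
      push_cast
      nlinarith [hx.2]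
    · linarith [Nat.floor_le h0]
    · linarith [Nat.lt_floor_add_one (((m : ℝ) + 1) * x)]
    · field_simp
      ring

/-- Digit sequences that first differ at position `n` give sums in base `m + 2` that are far apart
and sums in base `m + 1` that are close. -/
lemma digit_separation {m : ℕ} (hm : 1 ≤ m) (n : ℕ) : ∀ (ε δ : ℕ → ℕ) (x x' y y' : ℝ),
    (∀ i, ε i ≤ m) → (∀ i, δ i ≤ m) → (∀ i < n, ε i = δ i) → ε n ≠ δ n →
    HasSum (fun i => (ε i : ℝ) / ((m : ℝ) + 2) ^ (i + 1)) x →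
    HasSum (fun i => (δ i : ℝ) / ((m : ℝ) + 2) ^ (i + 1)) x' →
    HasSum (fun i => (ε i : ℝ) / ((m : ℝ) + 1) ^ (i + 1)) y →
    HasSum (fun i => (δ i : ℝ) / ((m : ℝ) + 1) ^ (i + 1)) y' →
    1 / ((m : ℝ) + 1) ≤ |x - x'| * ((m : ℝ) + 2) ^ (n + 1) ∧ |y - y'| * ((m : ℝ) + 1) ^ n ≤ 1 := by
  have hm' : (1 : ℝ) ≤ m := by exact_mod_cast hm
  have hb : (1 : ℝ) < m + 2 := by linarith
  have hc : (1 : ℝ) < m + 1 := by linarith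
  -- With digit m+1 missing in base m+2 the sums stop at m/(m+1), so pieces with different first
  -- digits are, after scaling by m+2, at distance at least 1/(m+1).
  have hbound : ∀ (ε : ℕ → ℕ) (x : ℝ), (∀ i, ε i ≤ m) →
      HasSum (fun i => (ε i : ℝ) / ((m : ℝ) + 2) ^ (i + 1)) x → 0 ≤ x ∧ x ≤ 1 - 1 / ((m : ℝ) + 1) := by
    intro ε x hε h
    have := digitSums_subset_Icc hb (D := Iic m) (fun _ h => h) ⟨ε, hε, h⟩
    refine ⟨this.1, this.2.trans_eq ?_⟩
    have : (m : ℝ) + 2 - 1 = m + 1 := by ring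
    rw [this]
    field_simp
    ring
  have hbound' : ∀ (ε : ℕ → ℕ) (x : ℝ), (∀ i, ε i ≤ m) →
      HasSum (fun i => (ε i : ℝ) / ((m : ℝ) + 1) ^ (i + 1)) x → 0 ≤ x ∧ x ≤ 1 := by
    intro ε x hε h
    have := digitSums_subset_Icc hc (D := Iic m) (fun _ h => h) ⟨ε, hε, h⟩
    refine ⟨this.1, this.2.trans_eq ?_⟩
    rw [add_sub_cancel_right]
    field_simp
  induction n with
  | zero =>
    intro ε δ x x' y y' hε hδ _ hne hx hx' hy hy'
    have h1 := hbound _ _ (fun i => hε (i + 1)) (hasSum_digits_tail hb hx)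
    have h2 := hbound _ _ (fun i => hδ (i + 1)) (hasSum_digits_tail hb hx')
    have h3 := hbound' _ _ hε hy
    have h4 := hbound' _ _ hδ hy'
    constructor
    · rw [zero_add, pow_one, ← abs_of_pos (by linarith : (0 : ℝ) < m + 2), ← abs_mul, le_abs]
      rcases lt_or_gt_of_ne hne with h | h
      · right
        have : (ε 0 : ℝ) + 1 ≤ δ 0 := by exact_mod_cast h
        linarith
      · left
        have : (δ 0 : ℝ) + 1 ≤ ε 0 := by exact_mod_cast h
        linarith
    · rw [pow_zero, mul_one, abs_le]
      constructor <;> linarith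
  | succ n ih =>
    intro ε δ x x' y y' hε hδ heq hne hx hx' hy hy'
    obtain ⟨h1, h2⟩ := ih _ _ _ _ _ _ (fun i => hε (i + 1)) (fun i => hδ (i + 1))
      (fun i hi => heq (i + 1) (by omega)) hne (hasSum_digits_tail hb hx) (hasSum_digits_tail hb hx')
      (hasSum_digits_tail hc hy) (hasSum_digits_tail hc hy')
    rw [heq 0 (by omega), sub_sub_sub_cancel_right, ← mul_sub, abs_mul, abs_of_pos (by linarith)]
      at h1 h2
    exact ⟨h1.trans_eq (by ring), (le_of_eq (by ring)).trans h2⟩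

/-- The similarity dimension of the boundary of `K_l`. -/
noncomputable def boundaryDim (l : ℕ) : ℝ := Real.log (2 * (l : ℝ) + 1) / Real.log (2 * (l : ℝ) + 2)

variable {l : ℕ}

lemma boundaryDim_pos (hl : 1 ≤ l) : 0 < boundaryDim l := by
  have hl' : (1 : ℝ) ≤ l := by exact_mod_cast hl
  exact div_pos (Real.log_pos (by linarith)) (Real.log_pos (by linarith))

lemma boundaryDim_lt_one (l : ℕ) : boundaryDim l < 1 := by
  have hl' : (0 : ℝ) ≤ l := by positivity
  rw [boundaryDim, div_lt_one (Real.log_pos (by linarith))]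
  exact Real.log_lt_log (by linarith) (by linarith)

lemma base_rpow_boundaryDim (l : ℕ) : (2 * (l : ℝ) + 2) ^ boundaryDim l = 2 * l + 1 := by
  have hl' : (0 : ℝ) ≤ l := by positivity
  have := (Real.log_pos (show (1 : ℝ) < 2 * l + 2 by linarith)).ne'
  rw [Real.rpow_def_of_pos (by linarith), boundaryDim, mul_div_cancel₀ _ this,
    Real.exp_log (by linarith)]

lemma exists_cover_overlapSet (l n : ℕ) : ∃ F : Finset ℝ, F.card ≤ (2 * l + 1) ^ n ∧
    ∀ x ∈ overlapSet l, ∃ c ∈ F, x ∈ Icc c (c + 1 / (2 * (l : ℝ) + 2) ^ n) := by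
  have hb := one_lt_base l
  induction n with
  | zero =>
    refine ⟨{0}, by simp, fun x hx => ⟨0, by simp, ?_⟩⟩
    have h := overlapSet_bounds hx
    have := fixedPoint_lt_one l
    rw [pow_zero]
    exact ⟨h.1, by linarith⟩
  | succ n ih =>
    obtain ⟨F, hF, hcov⟩ := ih
    refine ⟨(F ×ˢ Finset.range (2 * l + 1)).image fun q => (q.1 + (q.2 : ℝ)) / (2 * l + 2), ?_, ?_⟩
    · refine Finset.card_image_le.trans ?_
      rw [Finset.card_product, Finset.card_range, pow_succ]
      gcongr
    · intro x hx
      obtain ⟨j, hj, y, hy, rfl⟩ := overlapSet_uncons hx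
      obtain ⟨c, hc, hcy⟩ := hcov y hy
      refine ⟨(c + j) / (2 * l + 2), Finset.mem_image.2 ⟨(c, j), ?_, rfl⟩, ?_, ?_⟩
      · simp [hc]
        omega
      · have := hcy.1
        gcongr
      · have := hcy.2
        rw [pow_succ, ← div_div, ← add_div, div_le_div_iff_of_pos_right (by linarith)]
        linarith

/-- At level n there are at most (2l+1)^n intervals of length (2l+2)^(-n), and the s-th power of
that length is (2l+1)^(-n) for s = `boundaryDim l`; hence the s-dimensional measure is at most 1. -/
lemma dimH_overlapSet_le (hl : 1 ≤ l) : dimH (overlapSet l) ≤ ENNReal.ofReal (boundaryDim l) := by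
  have hb := one_lt_base l
  have hs := boundaryDim_pos hl
  choose F hF hcov using exists_cover_overlapSet l
  have hdiam : ∀ n, ∀ c : F n, Metric.ediam (Icc (c : ℝ) (c + 1 / (2 * (l : ℝ) + 2) ^ n)) =
      ENNReal.ofReal (1 / (2 * (l : ℝ) + 2) ^ n) := fun n c => by
    rw [Real.ediam_Icc, add_sub_cancel_left]
  have h0 : Tendsto (fun n : ℕ => ENNReal.ofReal (1 / (2 * (l : ℝ) + 2) ^ n)) atTop (𝓝 0) := by
    have : Tendsto (fun n : ℕ => 1 / (2 * (l : ℝ) + 2) ^ n) atTop (𝓝 0) :=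
      tendsto_const_nhds.div_atTop (tendsto_pow_atTop_atTop_of_one_lt hb)
    simpa using ENNReal.tendsto_ofReal this
  have hmeas : μH[boundaryDim l] (overlapSet l) ≤ 1 := by
    refine (Measure.hausdorffMeasure_le_liminf_sum (boundaryDim l) (overlapSet l)
      (fun n : ℕ => ENNReal.ofReal (1 / (2 * (l : ℝ) + 2) ^ n)) h0
      (fun n (c : F n) => Icc (c : ℝ) (c + 1 / (2 * (l : ℝ) + 2) ^ n))
      (Eventually.of_forall fun n c => (hdiam n c).le)
      (Eventually.of_forall fun n x hx => ?_)).trans ?_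
    · obtain ⟨c, hc, hxc⟩ := hcov n x hx
      exact mem_iUnion.2 ⟨⟨c, hc⟩, hxc⟩
    · refine liminf_le_of_le (by isBoundedDefault) fun a ha => ?_
      obtain ⟨n, hn⟩ := ha.exists
      refine hn.trans ?_
      simp only [hdiam, Finset.sum_const, Finset.card_univ, Fintype.card_coe, nsmul_eq_mul]
      rw [ENNReal.ofReal_rpow_of_nonneg (by positivity) hs.le]
      have h1 : (1 / (2 * (l : ℝ) + 2) ^ n) ^ boundaryDim l = 1 / (2 * (l : ℝ) + 1) ^ n := by
        rw [Real.div_rpow zero_le_one (by positivity), Real.one_rpow, ← Real.rpow_natCast,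
          ← Real.rpow_mul (by positivity), mul_comm (n : ℝ),
          Real.rpow_mul (by positivity), base_rpow_boundaryDim, Real.rpow_natCast]
      rw [h1]
      calc ((F n).card : ℝ≥0∞) * ENNReal.ofReal (1 / (2 * (l : ℝ) + 1) ^ n)
          ≤ ENNReal.ofReal ((2 * (l : ℝ) + 1) ^ n) * ENNReal.ofReal (1 / (2 * (l : ℝ) + 1) ^ n) := by
            gcongr
            rw [← ENNReal.ofReal_natCast]
            exact ENNReal.ofReal_le_ofReal (by exact_mod_cast hF n)
        _ = 1 := by
            rw [← ENNReal.ofReal_mul (by positivity), mul_one_div_cancel (by positivity),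
              ENNReal.ofReal_one]
  have hs' : ((boundaryDim l).toNNReal : ℝ) = boundaryDim l := Real.coe_toNNReal _ hs.le
  refine dimH_le_of_hausdorffMeasure_ne_top (d := (boundaryDim l).toNNReal) ?_
  rw [hs']
  exact (hmeas.trans_lt ENNReal.one_lt_top).ne

/-- Rereading an expansion in base 2l+1 is Hölder of exponent s = `boundaryDim l`, and its image
contains [0, 1), so 1 ≤ dim / s. -/
lemma le_dimH_overlapSet (hl : 1 ≤ l) : ENNReal.ofReal (boundaryDim l) ≤ dimH (overlapSet l) := by
  have hs := boundaryDim_pos hl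
  have hs' : ((boundaryDim l).toNNReal : ℝ) = boundaryDim l := Real.coe_toNNReal _ hs.le
  have hm : 1 ≤ 2 * l := by omega
  have hcast : ((2 * l : ℕ) : ℝ) = 2 * l := by push_cast; rfl
  have hdig : ∀ x ∈ overlapSet l, ∃ ε : ℕ → ℕ, (∀ i, ε i ≤ 2 * l) ∧
      HasSum (fun i => (ε i : ℝ) / (((2 * l : ℕ) : ℝ) + 2) ^ (i + 1)) x := fun x hx => by
    rw [overlapSet_eq_digitSums, ← hcast] at hx
    exact hx
  choose! ε hε hsum using hdig
  have hc : (1 : ℝ) < ((2 * l : ℕ) : ℝ) + 1 := by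
    have : (1 : ℝ) ≤ ((2 * l : ℕ) : ℝ) := by exact_mod_cast hm
    linarith
  set g : ℝ → ℝ := fun x => ∑' i, (ε x i : ℝ) / (((2 * l : ℕ) : ℝ) + 1) ^ (i + 1)
  have hg : ∀ x ∈ overlapSet l,
      HasSum (fun i => (ε x i : ℝ) / (((2 * l : ℕ) : ℝ) + 1) ^ (i + 1)) (g x) := fun x hx =>
    (summable_digits hc (hε x hx)).hasSum
  -- If the digits first differ at position n, then `digit_separation` raised to the power s gives
  -- (2l+1)^(-s) ≤ |x - x'|^s (2l+1)^(n+1), while |y - y'| ≤ (2l+1)^(-n).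
  set C : ℝ := (2 * (l : ℝ) + 1) * (2 * (l : ℝ) + 1) ^ boundaryDim l
  have hC : 0 ≤ C := by positivity
  have hholder : ∀ (ε δ : ℕ → ℕ) (x x' y y' : ℝ), (∀ i, ε i ≤ 2 * l) → (∀ i, δ i ≤ 2 * l) →
      HasSum (fun i => (ε i : ℝ) / (((2 * l : ℕ) : ℝ) + 2) ^ (i + 1)) x →
      HasSum (fun i => (δ i : ℝ) / (((2 * l : ℕ) : ℝ) + 2) ^ (i + 1)) x' →
      HasSum (fun i => (ε i : ℝ) / (((2 * l : ℕ) : ℝ) + 1) ^ (i + 1)) y →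
      HasSum (fun i => (δ i : ℝ) / (((2 * l : ℕ) : ℝ) + 1) ^ (i + 1)) y' →
      |y - y'| ≤ C * |x - x'| ^ boundaryDim l := by
    intro ε δ x x' y y' hε hδ hx hx' hy hy'
    by_cases heq : ε = δ
    · subst heq
      rw [hy.unique hy', sub_self, abs_zero]
      positivity
    · have hex : ∃ n, ε n ≠ δ n := Function.ne_iff.1 heq
      classical
      obtain ⟨h1, h2⟩ := digit_separation hm (Nat.find hex) ε δ x x' y y' hε hδ
        (fun i hi => not_not.1 (Nat.find_min hex hi)) (Nat.find_spec hex) hx hx' hy hy'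
      generalize Nat.find hex = n at h1 h2
      rw [hcast] at h1 h2
      have h3 : (1 / (2 * (l : ℝ) + 1)) ^ boundaryDim l ≤
          |x - x'| ^ boundaryDim l * (2 * (l : ℝ) + 1) ^ (n + 1) := by
        refine (Real.rpow_le_rpow (by positivity) h1 hs.le).trans_eq ?_
        rw [Real.mul_rpow (abs_nonneg _) (by positivity), ← base_rpow_boundaryDim l,
          ← Real.rpow_natCast, ← Real.rpow_natCast, ← Real.rpow_mul (by positivity),
          ← Real.rpow_mul (by positivity), mul_comm (boundaryDim l)]
      rw [Real.div_rpow zero_le_one (by positivity), Real.one_rpow, div_le_iff₀ (by positivity)] at h3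
      have hpos : (0 : ℝ) < (2 * (l : ℝ) + 1) ^ n := by positivity
      refine le_of_mul_le_mul_right (h2.trans (h3.trans_eq ?_)) hpos
      rw [pow_succ]
      ring
  have hHol : HolderOnWith C.toNNReal (boundaryDim l).toNNReal g (overlapSet l) := by
    intro x hx y hy
    rw [edist_dist, edist_dist, hs', ENNReal.ofReal_rpow_of_nonneg dist_nonneg hs.le,
      show ((C.toNNReal : ℝ≥0) : ℝ≥0∞) = ENNReal.ofReal C from rfl, ← ENNReal.ofReal_mul hC]
    exact ENNReal.ofReal_le_ofReal
      (hholder _ _ _ _ _ _ (hε x hx) (hε y hy) (hsum x hx) (hsum y hy) (hg x hx) (hg y hy))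
  have himg : Ico (0 : ℝ) 1 ⊆ g '' overlapSet l := by
    intro y hy
    obtain ⟨δ, hδ, hyδ⟩ := Ico_subset_digitSums hm hy
    have hb : (1 : ℝ) < ((2 * l : ℕ) : ℝ) + 2 := by linarith
    have hx := (summable_digits hb hδ).hasSum
    set x := ∑' i, (δ i : ℝ) / (((2 * l : ℕ) : ℝ) + 2) ^ (i + 1)
    have hxA : x ∈ overlapSet l := by
      rw [overlapSet_eq_digitSums, ← hcast]
      exact ⟨δ, hδ, hx⟩
    refine ⟨x, hxA, ?_⟩
    -- The chosen digits of `x` may differ a priori from `δ`; the Hölder bound at distance 0 shows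
    -- that both give the same sum in base 2l+1.
    have := hholder _ _ _ _ _ _ (hε x hxA) hδ (hsum x hxA) hx (hg x hxA) hyδ
    rw [sub_self, abs_zero, Real.zero_rpow hs.ne', mul_zero] at this
    exact sub_eq_zero.1 (abs_nonpos_iff.1 this)
  have hdim : dimH (Ico (0 : ℝ) 1) = 1 := by
    rw [Real.dimH_of_nonempty_interior (by simp)]
    simp
  have h1 := (hdim ▸ dimH_mono himg).trans
    (hHol.dimH_image_le (by rw [Real.toNNReal_pos]; exact hs))
  rw [ENNReal.le_div_iff_mul_le (by left; simpa using hs) (by left; simp), one_mul] at h1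
  exact h1

lemma dimH_overlapSet (hl : 1 ≤ l) : dimH (overlapSet l) = ENNReal.ofReal (boundaryDim l) :=
  le_antisymm (dimH_overlapSet_le hl) (le_dimH_overlapSet hl)

lemma dimH_frontier_selfSimilarK (hl : 1 ≤ l) :
    dimH (frontier (selfSimilarK l)) = ENNReal.ofReal (boundaryDim l) := by
  rw [frontier_selfSimilarK hl, dimH_union, (isometry_add_right (1 : ℝ)).dimH_image,
    dimH_overlapSet hl, max_self]

lemma volume_overlapSet (hl : 1 ≤ l) : volume (overlapSet l) = 0 := by
  rw [← hausdorffMeasure_real]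
  refine hausdorffMeasure_of_dimH_lt (d := 1) ?_
  rw [dimH_overlapSet hl, ENNReal.coe_one, ENNReal.ofReal_lt_one]
  exact boundaryDim_lt_one l

lemma boundaryDim_ne_int (hl : 1 ≤ l) : ¬ ∃ m : ℤ, boundaryDim l = m := by
  rintro ⟨m, hm⟩
  have h0 := boundaryDim_pos hl
  have h1 := boundaryDim_lt_one l
  rw [hm] at h0 h1
  norm_cast at h0 h1
  omega

end Dimension

/-! ### The countable family of similar copies of the boundary -/

section Copies

variable {l : ℕ}

lemma mem_outerIndices {i : ℕ} :
    i ∈ outerIndices l ↔ (∃ k < l, i = k + 1) ∨ ∃ k < l, i = l + 3 + k := by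
  simp only [outerIndices, Finset.mem_union, Finset.mem_Icc]
  constructor
  · rintro (h | h)
    · exact Or.inl ⟨i - 1, by omega, by omega⟩
    · exact Or.inr ⟨i - (l + 3), by omega, by omega⟩
  · rintro (⟨k, hk, rfl⟩ | ⟨k, hk, rfl⟩) <;> omega

lemma card_outerIndices (l : ℕ) : (outerIndices l).card = 2 * l := by
  rw [outerIndices, Finset.card_union_of_disjoint]
  · simp only [Nat.card_Icc]
    omega
  · rw [Finset.disjoint_left]
    intro i
    simp only [Finset.mem_Icc]
    omega

lemma psi_left {k : ℕ} (hk : k ≤ l) (x : ℝ) : psi l (k + 1) x = (x + 2 * k) / (2 * l + 2) := by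
  rw [psi, if_pos (by omega)]
  push_cast
  ring

lemma psi_right (k : ℕ) (x : ℝ) :
    psi l (l + 2 + k) x = (x + (2 * l + 1 + 2 * k)) / (2 * l + 2) := by
  rw [psi, if_neg (by omega)]
  push_cast
  ring

lemma dist_psi (i : ℕ) (x y : ℝ) : dist (psi l i x) (psi l i y) = (2 * (l : ℝ) + 2)⁻¹ * dist x y := by
  have hb := one_lt_base l
  simp only [psi, Real.dist_eq]
  split_ifs <;>
    rw [← sub_div, add_sub_add_right_eq_sub, abs_div, abs_of_pos (by linarith : 0 < 2 * (l : ℝ) + 2),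
      div_eq_inv_mul]

lemma copyMap_succ (n i : ℕ) (x : ℝ) :
    copyMap l (n + 1) i x = psi l (if i ≤ l then l + 1 else l + 2) (copyMap l n i x) := by
  simp only [copyMap, Function.comp_apply, Function.iterate_succ_apply']

lemma copyMap_zero (i : ℕ) (x : ℝ) : copyMap l 0 i x = psi l i x := rfl

lemma copyMap_left_succ {k : ℕ} (hk : k < l) (n : ℕ) (x : ℝ) :
    copyMap l (n + 1) (k + 1) x = (copyMap l n (k + 1) x + 2 * l) / (2 * l + 2) := by
  rw [copyMap_succ, if_pos (by omega), psi_left le_rfl]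

lemma copyMap_right_succ (k n : ℕ) (x : ℝ) :
    copyMap l (n + 1) (l + 3 + k) x =
      (copyMap l n (l + 3 + k) x + (2 * l + 1)) / (2 * l + 2) := by
  rw [copyMap_succ, if_neg (by omega)]
  simpa using psi_right (l := l) 0 _

lemma copyMap_right_zero (k : ℕ) (x : ℝ) :
    copyMap l 0 (l + 3 + k) x = (x + (2 * l + 3 + 2 * k)) / (2 * l + 2) := by
  rw [copyMap_zero, show l + 3 + k = l + 2 + (k + 1) by ring, psi_right]
  push_cast
  ring

lemma dist_copyMap (n i : ℕ) (x y : ℝ) :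
    dist (copyMap l n i x) (copyMap l n i y) = ((2 * (l : ℝ) + 2) ^ (n + 1))⁻¹ * dist x y := by
  induction n with
  | zero => rw [copyMap_zero, copyMap_zero, dist_psi, zero_add, pow_one]
  | succ n ih =>
    rw [copyMap_succ, copyMap_succ, dist_psi, ih, pow_succ _ (n + 1), mul_inv]
    ring

/-- On A ∪ (A + 1), A the overlap, `psi l (k + 1)` prepends the digit 2k or 2k+1, both below 2l, and
`psi l (l + 1)` prepends 2l. The result is never the constant sequence 2l, whose sum is 2l/(2l+1).
-/
lemma copyMap_left_mem (hl : 1 ≤ l) {k : ℕ} (hk : k < l) (n : ℕ) {x : ℝ}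
    (hx : x ∈ frontier (selfSimilarK l)) :
    copyMap l n (k + 1) x ∈ overlapSet l ∧ copyMap l n (k + 1) x < 2 * l / (2 * l + 1) := by
  have hb := one_lt_base l
  have hp := fixedPoint_lt_one l
  have hp0 := fixedPoint_nonneg l
  have hbp := base_mul_fixedPoint l
  have hk' : (k : ℝ) + 1 ≤ l := by exact_mod_cast hk
  rw [frontier_selfSimilarK hl] at hx
  induction n with
  | zero =>
    rw [copyMap_zero, psi_left hk.le, div_lt_iff₀ (by linarith)]
    obtain hx | ⟨x, hx, rfl⟩ := hx
    · refine ⟨?_, by linarith [overlapSet_bounds hx]⟩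
      simpa using overlapSet_cons (j := 2 * k) (by omega) hx
    · refine ⟨?_, by linarith [overlapSet_bounds hx]⟩
      have := overlapSet_cons (j := 2 * k + 1) (by omega) hx
      push_cast at this
      rwa [← add_assoc, add_right_comm] at this
  | succ n ih =>
    rw [copyMap_left_succ hk, div_lt_iff₀ (by linarith)]
    refine ⟨?_, by linarith [ih.2]⟩
    simpa using overlapSet_cons (j := 2 * l) le_rfl ih.1

/-- Mirror image in the coordinate shifted by 1: index l+3+k prepends 2k+1 or 2k+2, and `psi l (l +
2)` prepends 0. -/
lemma copyMap_right_mem (hl : 1 ≤ l) {k : ℕ} (hk : k < l) (n : ℕ) {x : ℝ}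
    (hx : x ∈ frontier (selfSimilarK l)) :
    copyMap l n (l + 3 + k) x - 1 ∈ overlapSet l ∧ 1 < copyMap l n (l + 3 + k) x := by
  have hb := one_lt_base l
  have hb0 : (2 * (l : ℝ) + 2) ≠ 0 := by linarith
  have hk0 : (0 : ℝ) ≤ k := by positivity
  rw [frontier_selfSimilarK hl] at hx
  induction n with
  | zero =>
    rw [copyMap_right_zero, lt_div_iff₀ (by linarith)]
    obtain hx | ⟨x, hx, rfl⟩ := hx
    · refine ⟨?_, by linarith [overlapSet_bounds hx]⟩
      have := overlapSet_cons (j := 2 * k + 1) (by omega) hx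
      push_cast at this
      convert this using 1
      field_simp
      ring
    · refine ⟨?_, by linarith [overlapSet_bounds hx]⟩
      have := overlapSet_cons (j := 2 * k + 2) (by omega) hx
      push_cast at this
      convert this using 1
      field_simp
      ring
  | succ n ih =>
    rw [copyMap_right_succ, lt_div_iff₀ (by linarith)]
    refine ⟨?_, by linarith [ih.2]⟩
    have := overlapSet_cons (j := 0) (by omega) ih.1
    push_cast at this
    convert this using 1
    field_simp
    ring

lemma frontier_bounds {x : ℝ} (hx : x ∈ frontier (selfSimilarK l)) : 0 ≤ x ∧ x < 2 := by
  have h := selfSimilarK_bounds ((isCompact_selfSimilarK l).isClosed.frontier_subset hx)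
  exact ⟨h.1, by linarith [fixedPoint_lt_one l]⟩

lemma eq_of_even_digit_lt {k k' : ℕ} {x x' : ℝ} (hx : 0 ≤ x ∧ x < 2) (hx' : 0 ≤ x' ∧ x' < 2)
    (h : x + 2 * k = x' + 2 * k') : k = k' := by
  have h1 : (k : ℝ) < k' + 1 := by linarith
  have h2 : (k' : ℝ) < k + 1 := by linarith
  norm_cast at h1 h2
  omega

/-- The exponent n is recovered as the number of leading digits 2l, and k from the pair {2k, 2k+1}
containing the next digit. -/
lemma copyMap_left_inj (hl : 1 ≤ l) {k k' : ℕ} (hk : k < l) (hk' : k' < l) (n m : ℕ) {x x' : ℝ}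
    (hx : x ∈ frontier (selfSimilarK l)) (hx' : x' ∈ frontier (selfSimilarK l))
    (h : copyMap l n (k + 1) x = copyMap l m (k' + 1) x') : n = m ∧ k = k' := by
  have hb := one_lt_base l
  -- Before division by 2l+2, the left side is below 2 + 2(l-1) = 2l and the right side is at least
  -- 2l.
  have hne : ∀ {k k' : ℕ}, k < l → k' < l → ∀ {x x' : ℝ}, x ∈ frontier (selfSimilarK l) →
      x' ∈ frontier (selfSimilarK l) → ∀ m, copyMap l 0 (k + 1) x ≠ copyMap l (m + 1) (k' + 1) x' := by
    intro k k' hk hk' x x' hx hx' m h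
    rw [copyMap_zero, psi_left hk.le, copyMap_left_succ hk', div_left_inj' (by linarith)] at h
    have h1 := overlapSet_bounds (copyMap_left_mem hl hk' m hx').1
    have h2 := frontier_bounds hx
    have h3 : (k : ℝ) + 1 ≤ l := by exact_mod_cast hk
    linarith
  induction n generalizing m with
  | zero =>
    cases m with
    | zero =>
      rw [copyMap_zero, psi_left hk.le, copyMap_zero, psi_left hk'.le, div_left_inj' (by linarith)] at h
      exact ⟨rfl, eq_of_even_digit_lt (frontier_bounds hx) (frontier_bounds hx') h⟩
    | succ m => exact absurd h (hne hk hk' hx hx' m)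
  | succ n ih =>
    cases m with
    | zero => exact absurd h.symm (hne hk' hk hx' hx n)
    | succ m =>
      rw [copyMap_left_succ hk, copyMap_left_succ hk', div_left_inj' (by linarith),
        add_left_inj] at h
      obtain ⟨rfl, rfl⟩ := ih m h
      exact ⟨rfl, rfl⟩

lemma copyMap_right_inj (hl : 1 ≤ l) {k k' : ℕ} (hk : k < l) (hk' : k' < l) (n m : ℕ) {x x' : ℝ}
    (hx : x ∈ frontier (selfSimilarK l)) (hx' : x' ∈ frontier (selfSimilarK l))
    (h : copyMap l n (l + 3 + k) x = copyMap l m (l + 3 + k') x') : n = m ∧ k = k' := by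
  have hb := one_lt_base l
  have hne : ∀ {k k' : ℕ}, k' < l → ∀ {x x' : ℝ}, x ∈ frontier (selfSimilarK l) →
      x' ∈ frontier (selfSimilarK l) →
      ∀ m, copyMap l 0 (l + 3 + k) x ≠ copyMap l (m + 1) (l + 3 + k') x' := by
    intro k k' hk' x x' hx hx' m h
    rw [copyMap_right_zero, copyMap_right_succ, div_left_inj' (by linarith)] at h
    have h1 := overlapSet_bounds (copyMap_right_mem hl hk' m hx').1
    have h2 := frontier_bounds hx
    have h3 : (0 : ℝ) ≤ k := by positivity
    have h4 := fixedPoint_lt_one l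
    linarith
  induction n generalizing m with
  | zero =>
    cases m with
    | zero =>
      rw [copyMap_right_zero, copyMap_right_zero, div_left_inj' (by linarith)] at h
      exact ⟨rfl, eq_of_even_digit_lt (frontier_bounds hx) (frontier_bounds hx') (by linarith)⟩
    | succ m => exact absurd h (hne hk' hx hx' m)
  | succ n ih =>
    cases m with
    | zero => exact absurd h.symm (hne hk hx' hx n)
    | succ m =>
      rw [copyMap_right_succ, copyMap_right_succ, div_left_inj' (by linarith), add_left_inj] at h
      obtain ⟨rfl, rfl⟩ := ih m h
      exact ⟨rfl, rfl⟩

lemma pairwiseDisjoint_copies (hl : 1 ≤ l) :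
    {p : ℕ × ℕ | p.2 ∈ outerIndices l}.PairwiseDisjoint
      (fun p => copyMap l p.1 p.2 '' frontier (selfSimilarK l)) := by
  have hp := fixedPoint_lt_one l
  rintro ⟨n, i⟩ hi ⟨m, j⟩ hj hne
  rw [Function.onFun, disjoint_left]
  rintro _ ⟨x, hx, rfl⟩ ⟨y, hy, hxy⟩
  dsimp only at hxy
  apply hne
  obtain ⟨k, hk, hik⟩ | ⟨k, hk, hik⟩ := mem_outerIndices.1 hi <;>
  obtain ⟨k', hk', hjk⟩ | ⟨k', hk', hjk⟩ := mem_outerIndices.1 hj <;>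
  dsimp only at hik hjk <;> subst hik hjk
  · obtain ⟨rfl, rfl⟩ := copyMap_left_inj hl hk' hk _ _ hy hx hxy
    rfl
  · linarith [(copyMap_left_mem hl hk n hx).2, (copyMap_right_mem hl hk' m hy).2]
  · linarith [(copyMap_left_mem hl hk' m hy).2, (copyMap_right_mem hl hk n hx).2]
  · obtain ⟨rfl, rfl⟩ := copyMap_right_inj hl hk' hk _ _ hy hx hxy
    rfl

/-- Leading digits 2l are stripped until another digit appears, which identifies the copy. If n of
them are stripped without success, the point is within (2l+2)^(-n) of the fixed point; letting n
grow leaves that point only. -/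
lemma exists_copyMap_left (hl : 1 ≤ l) (n : ℕ) : ∀ x ∈ overlapSet l,
    (∃ m, ∃ k < l, ∃ y ∈ frontier (selfSimilarK l), copyMap l m (k + 1) y = x) ∨
      |x - 2 * l / (2 * l + 1)| ≤ 1 / (2 * l + 2) ^ n := by
  have hb := one_lt_base l
  have hbp := base_mul_fixedPoint l
  induction n with
  | zero =>
    intro x hx
    right
    have h := overlapSet_bounds hx
    have := fixedPoint_lt_one l
    rw [pow_zero, div_one, abs_le]
    constructor <;> linarith
  | succ n ih =>
    intro x hx
    obtain ⟨j, hj, y, hy, rfl⟩ := overlapSet_uncons hx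
    obtain rfl | hj := hj.eq_or_lt
    · obtain ⟨m, k, hk, z, hz, rfl⟩ | h := ih y hy
      · refine Or.inl ⟨m + 1, k, hk, z, hz, ?_⟩
        rw [copyMap_left_succ hk]
        push_cast
        rfl
      · right
        have heq : (y + (2 * l : ℕ)) / (2 * l + 2) - 2 * (l : ℝ) / (2 * l + 1) =
            (y - 2 * l / (2 * l + 1)) / (2 * l + 2) := by
          push_cast
          field_simp
          ring
        rw [heq, abs_div, abs_of_pos (by linarith : 0 < 2 * (l : ℝ) + 2), pow_succ, ← div_div]
        gcongr
    · left
      rw [frontier_selfSimilarK hl]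
      obtain ⟨k, rfl | rfl⟩ := Nat.even_or_odd' j
      · refine ⟨0, k, by omega, y, Or.inl hy, ?_⟩
        rw [copyMap_zero, psi_left (by omega)]
        push_cast
        rfl
      · refine ⟨0, k, by omega, y + 1, Or.inr ⟨y, hy, rfl⟩, ?_⟩
        rw [copyMap_zero, psi_left (by omega)]
        push_cast
        ring

lemma exists_copyMap_right (hl : 1 ≤ l) (n : ℕ) : ∀ x ∈ overlapSet l,
    (∃ m, ∃ k < l, ∃ y ∈ frontier (selfSimilarK l), copyMap l m (l + 3 + k) y = x + 1) ∨
      |x| ≤ 1 / (2 * l + 2) ^ n := by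
  have hb := one_lt_base l
  induction n with
  | zero =>
    intro x hx
    right
    have h := overlapSet_bounds hx
    have := fixedPoint_lt_one l
    rw [pow_zero, div_one, abs_le]
    constructor <;> linarith
  | succ n ih =>
    intro x hx
    obtain ⟨j, hj, y, hy, rfl⟩ := overlapSet_uncons hx
    obtain rfl | hj0 := Nat.eq_zero_or_pos j
    · obtain ⟨m, k, hk, z, hz, h⟩ | h := ih y hy
      · refine Or.inl ⟨m + 1, k, hk, z, hz, ?_⟩
        rw [copyMap_right_succ, h]
        push_cast
        field_simp
        ring
      · right
        rw [Nat.cast_zero, add_zero, abs_div, abs_of_pos (by linarith : 0 < 2 * (l : ℝ) + 2),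
          pow_succ, ← div_div]
        gcongr
    · left
      obtain ⟨j, rfl⟩ : ∃ i, j = i + 1 := ⟨j - 1, by omega⟩
      rw [frontier_selfSimilarK hl]
      obtain ⟨k, rfl | rfl⟩ := Nat.even_or_odd' j
      · refine ⟨0, k, by omega, y, Or.inl hy, ?_⟩
        rw [copyMap_right_zero]
        push_cast
        field_simp
        ring
      · refine ⟨0, k, by omega, y + 1, Or.inr ⟨y, hy, rfl⟩, ?_⟩
        rw [copyMap_right_zero]
        push_cast
        field_simp
        ring

lemma eq_zero_of_abs_le_pow {x : ℝ} (h : ∀ n : ℕ, |x| ≤ 1 / (2 * (l : ℝ) + 2) ^ n) : x = 0 := by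
  have h0 : Tendsto (fun n : ℕ => 1 / (2 * (l : ℝ) + 2) ^ n) atTop (𝓝 0) :=
    tendsto_const_nhds.div_atTop (tendsto_pow_atTop_atTop_of_one_lt (one_lt_base l))
  exact abs_nonpos_iff.1 (ge_of_tendsto' h0 h)

lemma iUnion_copies (hl : 1 ≤ l) :
    (⋃ n : ℕ, ⋃ i ∈ outerIndices l, copyMap l n i '' frontier (selfSimilarK l)) =
      frontier (selfSimilarK l) \ {2 * (l : ℝ) / (2 * (l : ℝ) + 1), 1} := by
  have hp := fixedPoint_lt_one l
  ext x
  simp only [mem_iUnion, mem_image, exists_prop, Set.mem_sdiff, mem_insert_iff, mem_singleton_iff, not_or]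
  constructor
  · rintro ⟨n, i, hi, y, hy, rfl⟩
    rcases mem_outerIndices.1 hi with ⟨k, hk, rfl⟩ | ⟨k, hk, rfl⟩
    · have h := copyMap_left_mem hl hk n hy
      refine ⟨?_, h.2.ne, (h.2.trans hp).ne⟩
      rw [frontier_selfSimilarK hl]
      exact Or.inl h.1
    · have h := copyMap_right_mem hl hk n hy
      refine ⟨?_, (hp.trans h.2).ne', h.2.ne'⟩
      rw [frontier_selfSimilarK hl]
      exact Or.inr ⟨_, h.1, by simp⟩
  · rintro ⟨hx, hxp, hx1⟩
    have hx' := hx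
    rw [frontier_selfSimilarK hl] at hx'
    obtain hxA | ⟨x, hxA, rfl⟩ := hx'
    · obtain ⟨m, k, hk, y, hy, h⟩ : ∃ m, ∃ k < l, ∃ y ∈ frontier (selfSimilarK l),
          copyMap l m (k + 1) y = x := by
        by_contra hcon
        exact hxp (sub_eq_zero.1 (eq_zero_of_abs_le_pow fun n =>
          (exists_copyMap_left hl n x hxA).resolve_left hcon))
      exact ⟨m, k + 1, mem_outerIndices.2 (Or.inl ⟨k, hk, rfl⟩), y, hy, h⟩
    · obtain ⟨m, k, hk, y, hy, h⟩ : ∃ m, ∃ k < l, ∃ y ∈ frontier (selfSimilarK l),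
          copyMap l m (l + 3 + k) y = x + 1 := by
        by_contra hcon
        have h0 : x = 0 := eq_zero_of_abs_le_pow fun n =>
          (exists_copyMap_right hl n x hxA).resolve_left hcon
        exact hx1 (by simp [h0])
      exact ⟨m, l + 3 + k, mem_outerIndices.2 (Or.inr ⟨k, hk, rfl⟩), y, hy, h⟩

lemma fixedPoints_mem_frontier (hl : 1 ≤ l) :
    ({2 * (l : ℝ) / (2 * (l : ℝ) + 1), 1} : Set ℝ) ⊆ frontier (selfSimilarK l) := by
  rw [frontier_selfSimilarK hl]
  rintro x (rfl | rfl)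
  · exact Or.inl (fixedPoint_mem_overlapSet l)
  · exact Or.inr ⟨0, zero_mem_overlapSet l, by simp⟩

lemma closure_frontier_diff (hl : 1 ≤ l) :
    closure (frontier (selfSimilarK l) \ {2 * (l : ℝ) / (2 * (l : ℝ) + 1), 1}) =
      frontier (selfSimilarK l) := by
  have hp := fixedPoint_lt_one l
  apply Subset.antisymm (closure_minimal sdiff_subset isClosed_frontier)
  intro x hx
  by_cases hx' : x ∈ ({2 * (l : ℝ) / (2 * (l : ℝ) + 1), 1} : Set ℝ)
  · rw [Metric.mem_closure_iff]
    intro ε hε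
    rw [frontier_selfSimilarK hl]
    obtain rfl | rfl := hx'
    · obtain ⟨⟨a, ha, b, hb, hab, hax, -⟩, -⟩ :=
        exists_gaps_overlapSet_lt hl (fixedPoint_mem_overlapSet l) hε
      have hbp := overlapSet_bounds hb
      refine ⟨a, ⟨Or.inl ha, ?_⟩, by rwa [dist_comm]⟩
      rintro (h | h)
      · linarith
      · rw [mem_singleton_iff] at h
        linarith
    · obtain ⟨⟨a, ha, b, hb, hab, -, hbx, -⟩, -⟩ :=
        exists_gaps_overlapSet_lt hl (zero_mem_overlapSet l) hε
      have hap := overlapSet_bounds ha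
      refine ⟨b + 1, ⟨Or.inr ⟨b, hb, rfl⟩, ?_⟩, ?_⟩
      · rintro (h | h)
        · linarith
        · rw [mem_singleton_iff] at h
          linarith
      · rw [dist_comm, Real.dist_eq]
        simpa using hbx
  · exact subset_closure ⟨hx, hx'⟩

end Copies

/-! ### Back-and-forth for coloured countable linear orders -/

section ColouredOrder

variable {α β κ : Type*} [LinearOrder α] [LinearOrder β]

/-- In a linear order with colouring `c`, every colour occurs between any two finite sets. -/
def ColourDense (c : α → κ) : Prop :=
  ∀ lo hi : Finset α, (∀ x ∈ lo, ∀ y ∈ hi, x < y) → ∀ k,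
    ∃ m, c m = k ∧ (∀ x ∈ lo, x < m) ∧ ∀ y ∈ hi, m < y

/-- A finite partial isomorphism of coloured linear orders. -/
def IsColouredPartialIso (c : α → κ) (d : β → κ) (f : Finset (α × β)) : Prop :=
  (∀ p ∈ f, ∀ q ∈ f, cmp p.1 q.1 = cmp p.2 q.2) ∧ ∀ p ∈ f, c p.1 = d p.2

variable {c : α → κ} {d : β → κ}

lemma IsColouredPartialIso.swap {f : Finset (α × β)} (hf : IsColouredPartialIso c d f) :
    IsColouredPartialIso d c (f.map (Equiv.prodComm α β).toEmbedding) := by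
  constructor
  · intro p hp q hq
    rw [Finset.mem_map_equiv] at hp hq
    exact (hf.1 _ hp _ hq).symm
  · intro p hp
    rw [Finset.mem_map_equiv] at hp
    exact (hf.2 _ hp).symm

/-- The image of a new point must lie above the images of the smaller points and below those of the
larger ones, with the right colour; colour density supplies it. -/
lemma IsColouredPartialIso.exists_insert {f : Finset (α × β)} (hf : IsColouredPartialIso c d f)
    (hd : ColourDense d) [DecidableEq (α × β)] (a : α) :
    ∃ b, IsColouredPartialIso c d (insert (a, b) f) := by
  suffices h : ∃ b, c a = d b ∧ ∀ p ∈ f, cmp p.1 a = cmp p.2 b by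
    obtain ⟨b, hab, hb⟩ := h
    refine ⟨b, fun p hp q hq => ?_, fun p hp => ?_⟩
    · rw [Finset.mem_insert] at hp hq
      rcases hp with (rfl | pf) <;> rcases hq with (rfl | qf)
      · simp only [cmp_self_eq_eq]
      · rw [cmp_eq_cmp_symm]
        exact hb _ qf
      · exact hb _ pf
      · exact hf.1 _ pf _ qf
    · rw [Finset.mem_insert] at hp
      rcases hp with (rfl | pf)
      exacts [hab, hf.2 _ pf]
  by_cases h : ∃ b, (a, b) ∈ f
  · obtain ⟨b, hb⟩ := h
    exact ⟨b, hf.2 _ hb, fun p hp => hf.1 _ hp _ hb⟩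
  classical
  have hlt : ∀ x ∈ {p ∈ f | p.1 < a}.image Prod.snd,
      ∀ y ∈ {p ∈ f | a < p.1}.image Prod.snd, x < y := by
    intro x hx y hy
    rw [Finset.mem_image] at hx hy
    obtain ⟨p, hp, rfl⟩ := hx
    obtain ⟨q, hq, rfl⟩ := hy
    rw [Finset.mem_filter] at hp hq
    rw [← lt_iff_lt_of_cmp_eq_cmp (hf.1 _ hp.1 _ hq.1)]
    exact hp.2.trans hq.2
  obtain ⟨b, hab, hlo, hhi⟩ := hd _ _ hlt (c a)
  refine ⟨b, hab.symm, fun p hp => ?_⟩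
  have hne : p.1 ≠ a := fun he => h ⟨p.2, he ▸ hp⟩
  rcases lt_or_gt_of_ne hne with hl | hr
  · have := hlo _ (Finset.mem_image.2 ⟨p, Finset.mem_filter.2 ⟨hp, hl⟩, rfl⟩)
    rw [← cmp_eq_lt_iff] at this hl
    rw [this, hl]
  · have := hhi _ (Finset.mem_image.2 ⟨p, Finset.mem_filter.2 ⟨hp, hr⟩, rfl⟩)
    rw [← cmp_eq_gt_iff] at this hr
    rw [this, hr]

/-- Coloured version of Cantor's isomorphism theorem. -/
theorem exists_colouredOrderIso [Countable α] [Countable β] (hc : ColourDense c)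
    (hd : ColourDense d) : ∃ e : α ≃o β, ∀ a, d (e a) = c a := by
  classical
  cases nonempty_encodable α
  cases nonempty_encodable β
  let left : α → Order.Cofinal {f // IsColouredPartialIso c d f} := fun a =>
    { carrier := {f | ∃ b, (a, b) ∈ f.1}
      isCofinal := fun f => by
        obtain ⟨b, hb⟩ := f.2.exists_insert hd a
        exact ⟨⟨_, hb⟩, ⟨b, Finset.mem_insert_self _ _⟩, Finset.subset_insert _ _⟩ }
  let right : β → Order.Cofinal {f // IsColouredPartialIso c d f} := fun b =>
    { carrier := {f | ∃ a, (a, b) ∈ f.1}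
      isCofinal := fun f => by
        obtain ⟨a, ha⟩ := f.2.swap.exists_insert hc b
        refine ⟨⟨_, ha.swap⟩, ⟨a, ?_⟩, fun p hp => ?_⟩
        · rw [Finset.mem_map_equiv]
          exact Finset.mem_insert_self _ _
        · rw [Finset.mem_map_equiv]
          refine Finset.mem_insert_of_mem ?_
          rw [Finset.mem_map_equiv]
          exact hp }
  let cof : α ⊕ β → Order.Cofinal {f // IsColouredPartialIso c d f} := Sum.elim left right
  -- An ideal of partial isomorphisms meeting every "`a` is in the domain" and "`b` is in the
  -- range"; being directed, its members glue to a total isomorphism.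
  let I := Order.idealOfCofinals ⟨∅, by simp [IsColouredPartialIso]⟩ cof
  have hF : ∀ a, ∃ b, ∃ f ∈ I, (a, b) ∈ f.1 := fun a => by
    obtain ⟨f, ⟨b, hb⟩, hf⟩ := Order.cofinal_meets_idealOfCofinals _ cof (Sum.inl a)
    exact ⟨b, f, hf, hb⟩
  have hG : ∀ b, ∃ a, ∃ f ∈ I, (a, b) ∈ f.1 := fun b => by
    obtain ⟨f, ⟨a, ha⟩, hf⟩ := Order.cofinal_meets_idealOfCofinals _ cof (Sum.inr b)
    exact ⟨a, f, hf, ha⟩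
  choose F fF hFI hF using hF
  choose G fG hGI hG using hG
  refine ⟨OrderIso.ofCmpEqCmp F G fun a b => ?_, fun a => ((fF a).2.2 _ (hF a)).symm⟩
  obtain ⟨m, -, fm, gm⟩ := I.directed _ (hFI a) _ (hGI b)
  exact m.2.1 (a, _) (fm (hF a)) (_, b) (gm (hG b))

lemma colourDense_of_exists_between [Nonempty α] (hlt : ∀ x : α, ∀ k, ∃ y < x, c y = k)
    (hgt : ∀ x : α, ∀ k, ∃ y > x, c y = k) (hbtw : ∀ x y : α, x < y → ∀ k, ∃ z, x < z ∧ z < y ∧ c z = k) :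
    ColourDense c := by
  intro lo hi h k
  rcases lo.eq_empty_or_nonempty with rfl | hlo <;> rcases hi.eq_empty_or_nonempty with rfl | hhi
  · obtain ⟨y, -, hy⟩ := hlt (Classical.arbitrary α) k
    exact ⟨y, hy, by simp, by simp⟩
  · obtain ⟨y, hyx, hy⟩ := hlt (hi.min' hhi) k
    exact ⟨y, hy, by simp, fun z hz => hyx.trans_le (Finset.min'_le hi z hz)⟩
  · obtain ⟨y, hyx, hy⟩ := hgt (lo.max' hlo) k
    exact ⟨y, hy, fun z hz => (Finset.le_max' lo z hz).trans_lt hyx, by simp⟩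
  · obtain ⟨z, hz1, hz2, hz⟩ := hbtw _ _ (h _ (lo.max'_mem hlo) _ (hi.min'_mem hhi)) k
    exact ⟨z, hz, fun x hx => (Finset.le_max' lo x hx).trans_lt hz1,
      fun y hy => hz2.trans_le (Finset.min'_le hi y hy)⟩

end ColouredOrder

/-! ### The ordered set of gaps -/

/-- A bounded component of the complement of `B`, given by its end points. -/
@[ext]
structure Gap (B : Set ℝ) where
  left : ℝ
  right : ℝ
  left_mem : left ∈ B
  right_mem : right ∈ B
  lt : left < right
  disjoint : Disjoint (Ioo left right) B

namespace Gap

variable {B : Set ℝ}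

lemma right_le_of_lt (g : Gap B) {x : ℝ} (hx : x ∈ B) (h : g.left < x) : g.right ≤ x := by
  by_contra! hlt
  exact disjoint_left.1 g.disjoint ⟨h, hlt⟩ hx

lemma left_injective : Function.Injective (left : Gap B → ℝ) := fun g h hgh =>
  Gap.ext hgh (le_antisymm (g.right_le_of_lt h.right_mem (hgh ▸ h.lt))
    (h.right_le_of_lt g.right_mem (hgh ▸ g.lt)))

noncomputable instance : LinearOrder (Gap B) := LinearOrder.lift' left left_injective

lemma lt_iff {g h : Gap B} : g < h ↔ g.left < h.left := Iff.rfl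

lemma right_le_left {g h : Gap B} (hgh : g < h) : g.right ≤ h.left :=
  g.right_le_of_lt h.left_mem hgh

lemma eq_of_mem {g h : Gap B} {x : ℝ} (hg : x ∈ Ioo g.left g.right) (hh : x ∈ Ioo h.left h.right) :
    g = h := by
  rcases lt_trichotomy g h with hlt | heq | hlt
  · linarith [right_le_left hlt, hg.2, hh.1]
  · exact heq
  · linarith [right_le_left hlt, hg.1, hh.2]

instance : Countable (Gap B) := by
  have h : (Set.univ : Set (Gap B)).PairwiseDisjoint fun g => Ioo g.left g.right := by
    intro g _ h _ hne
    exact disjoint_left.2 fun x hg hh => hne (eq_of_mem hg hh)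
  exact countable_univ_iff.1 (h.countable_of_isOpen (fun _ _ => isOpen_Ioo)
    fun g _ => nonempty_Ioo.2 g.lt)

/-- The affine map that takes the gap `g` to the gap `h`. -/
noncomputable def affine {B' : Set ℝ} (g : Gap B) (h : Gap B') (x : ℝ) : ℝ :=
  h.left + (x - g.left) / (g.right - g.left) * (h.right - h.left)

variable {B' : Set ℝ}

lemma affine_mem (g : Gap B) (h : Gap B') {x : ℝ} (hx : x ∈ Ioo g.left g.right) :
    affine g h x ∈ Ioo h.left h.right := by
  have hg := sub_pos.2 g.lt
  have hh := sub_pos.2 h.lt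
  have h1 : 0 < (x - g.left) / (g.right - g.left) := div_pos (by linarith [hx.1]) hg
  have h2 : (x - g.left) / (g.right - g.left) < 1 := (div_lt_one hg).2 (by linarith [hx.2])
  constructor <;> rw [affine]
  · linarith [mul_pos h1 hh]
  · linarith [mul_lt_mul_of_pos_right h2 hh]

lemma affine_strictMono (g : Gap B) (h : Gap B') : StrictMono (affine g h) := fun x y hxy => by
  have hg := sub_pos.2 g.lt
  have hh := sub_pos.2 h.lt
  simp only [affine]
  gcongr

lemma affine_affine (g : Gap B) (h : Gap B') (x : ℝ) : affine g h (affine h g x) = x := by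
  have hg := (sub_pos.2 g.lt).ne'
  have hh := (sub_pos.2 h.lt).ne'
  simp only [affine]
  field_simp
  ring

end Gap

/-! ### Topological uniqueness of the Cantorval -/

/-- `S` is a compact set of reals made of a set `B` and some of the bounded gaps of `B`, such that
gaps of `B` inside `S` and gaps outside `S` accumulate at every point of `B`. -/
structure IsCantorvalWithBoundary (S B : Set ℝ) : Prop where
  compact : IsCompact B
  nonempty : B.Nonempty
  subset : B ⊆ S
  hull : ∀ x ∈ S, sInf B ≤ x ∧ x ≤ sSup B
  gap : ∀ g : Gap B, Ioo g.left g.right ⊆ S ∨ Disjoint (Ioo g.left g.right) S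
  inner : ∀ x ∈ B, ∀ ε > 0, ∃ g : Gap B, |g.left - x| < ε ∧ |g.right - x| < ε ∧
    Ioo g.left g.right ⊆ S
  outer : ∀ x ∈ B, ∀ ε > 0, ∃ g : Gap B, |g.left - x| < ε ∧ |g.right - x| < ε ∧
    Disjoint (Ioo g.left g.right) S

namespace IsCantorvalWithBoundary

variable {S B S' B' : Set ℝ}

/-- The colour of a gap: whether it lies in `S`. -/
def colour (S : Set ℝ) (g : Gap B) : Prop := Ioo g.left g.right ⊆ S

lemma exists_gap_colour (h : IsCantorvalWithBoundary S B) {x ε : ℝ} (hx : x ∈ B) (hε : 0 < ε)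
    (k : Prop) : ∃ g : Gap B, x - ε < g.left ∧ g.right < x + ε ∧ colour S g = k := by
  by_cases hk : k
  · obtain ⟨g, h1, h2, h3⟩ := h.inner x hx ε hε
    exact ⟨g, by linarith [(abs_lt.1 h1).1], by linarith [(abs_lt.1 h2).2],
      propext ⟨fun _ => hk, fun _ => h3⟩⟩
  · obtain ⟨g, h1, h2, h3⟩ := h.outer x hx ε hε
    refine ⟨g, by linarith [(abs_lt.1 h1).1], by linarith [(abs_lt.1 h2).2],
      propext ⟨fun hg => ?_, fun hk' => absurd hk' hk⟩⟩
    obtain ⟨y, hy⟩ := nonempty_Ioo.2 g.lt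
    exact absurd (hg hy) (disjoint_left.1 h3 hy)

/-- Gaps of both colours accumulate at each end point of a gap, necessarily from outside it. So no
gap is extreme and no two are adjacent. -/
lemma colourDense (h : IsCantorvalWithBoundary S B) : ColourDense (colour S : Gap B → Prop) := by
  have hlt : ∀ x : Gap B, ∀ ε > 0, ∀ k, ∃ y < x, x.left - ε < y.left ∧ colour S y = k := by
    intro x ε hε k
    -- Capping the radius by the length of `x` keeps the right end of `g` short of that of `x`,
    -- which forces `g` to the left.
    obtain ⟨g, h1, h2, hk⟩ := h.exists_gap_colour x.left_mem (lt_min hε (sub_pos.2 x.lt)) k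
    have h3 := min_le_left ε (x.right - x.left)
    have h4 := min_le_right ε (x.right - x.left)
    refine ⟨g, ?_, by linarith, hk⟩
    rw [Gap.lt_iff]
    by_contra! hle
    linarith [x.right_le_of_lt g.right_mem (hle.trans_lt g.lt)]
  have hgt : ∀ x : Gap B, ∀ ε > 0, ∀ k, ∃ y > x, y.right < x.right + ε ∧ colour S y = k := by
    intro x ε hε k
    obtain ⟨g, h1, h2, hk⟩ := h.exists_gap_colour x.right_mem (lt_min hε (sub_pos.2 x.lt)) k
    have h3 := min_le_left ε (x.right - x.left)
    have h4 := min_le_right ε (x.right - x.left)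
    refine ⟨g, ?_, by linarith, hk⟩
    rw [gt_iff_lt, Gap.lt_iff]
    linarith
  have : Nonempty (Gap B) := by
    obtain ⟨x, hx⟩ := h.nonempty
    obtain ⟨g, -⟩ := h.inner x hx 1 one_pos
    exact ⟨g⟩
  refine colourDense_of_exists_between (fun x k => ?_) (fun x k => ?_) fun x y hxy k => ?_
  · obtain ⟨y, hy, -, hk⟩ := hlt x 1 one_pos k
    exact ⟨y, hy, hk⟩
  · obtain ⟨y, hy, -, hk⟩ := hgt x 1 one_pos k
    exact ⟨y, hy, hk⟩
  · obtain ⟨z, hz, hzy, hk⟩ := hgt x (y.right - x.right)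
      (sub_pos.2 ((Gap.right_le_left hxy).trans_lt y.lt)) k
    refine ⟨z, hz, ?_, hk⟩
    rw [Gap.lt_iff]
    by_contra! hle
    rcases hle.eq_or_lt with heq | hlt
    · linarith [z.right_le_of_lt y.right_mem (heq ▸ y.lt), y.right_le_of_lt z.right_mem (heq ▸ z.lt)]
    · linarith [Gap.right_le_left (show y < z from hlt), z.lt]

/-- The gap is bounded by the nearest points of `B` on either side, which exist by compactness. -/
lemma exists_gap_of_notMem (h : IsCantorvalWithBoundary S B) {x : ℝ}
    (hx : x ∈ Icc (sInf B) (sSup B)) (hxB : x ∉ B) : ∃ g : Gap B, x ∈ Ioo g.left g.right := by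
  have hlo : IsCompact (B ∩ Iic x) := h.compact.inter_right isClosed_Iic
  have hhi : IsCompact (B ∩ Ici x) := h.compact.inter_right isClosed_Ici
  have hlo' : (B ∩ Iic x).Nonempty := ⟨sInf B, h.compact.sInf_mem h.nonempty, hx.1⟩
  have hhi' : (B ∩ Ici x).Nonempty := ⟨sSup B, h.compact.sSup_mem h.nonempty, hx.2⟩
  have ha := hlo.sSup_mem hlo'
  have hb := hhi.sInf_mem hhi'
  have hax : sSup (B ∩ Iic x) < x := lt_of_le_of_ne ha.2 fun he => hxB (he ▸ ha.1)
  have hxb : x < sInf (B ∩ Ici x) := lt_of_le_of_ne hb.2 fun he => hxB (he ▸ hb.1)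
  refine ⟨⟨_, _, ha.1, hb.1, hax.trans hxb, disjoint_left.2 fun y hy hyB => ?_⟩, hax, hxb⟩
  rcases le_total y x with hyx | hyx
  · exact (le_csSup hlo.bddAbove ⟨hyB, hyx⟩).not_gt hy.1
  · exact (csInf_le hhi.bddBelow ⟨hyB, hyx⟩).not_gt hy.2

lemma mem_Icc_of_mem_gap (h : IsCantorvalWithBoundary S B) {g : Gap B} {x : ℝ}
    (hx : x ∈ Ioo g.left g.right) : x ∈ Icc (sInf B) (sSup B) :=
  ⟨(csInf_le h.compact.bddBelow g.left_mem).trans hx.1.le,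
    hx.2.le.trans (le_csSup h.compact.bddAbove g.right_mem)⟩

/-- The union of the gaps of `B` is dense in the convex hull of `B`. -/
lemma exists_mem_gap_between (h : IsCantorvalWithBoundary S B) {x y : ℝ}
    (hx : x ∈ Icc (sInf B) (sSup B)) (hy : y ∈ Icc (sInf B) (sSup B)) (hxy : x < y) :
    ∃ z ∈ Ioo x y, ∃ g : Gap B, z ∈ Ioo g.left g.right := by
  by_cases hB : ∃ z ∈ Ioo x y, z ∈ B
  · obtain ⟨z, hz, hzB⟩ := hB
    obtain ⟨g, h1, h2, -⟩ := h.exists_gap_colour hzB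
      (lt_min (sub_pos.2 hz.1) (sub_pos.2 hz.2)) True
    have h3 := min_le_left (z - x) (y - z)
    have h4 := min_le_right (z - x) (y - z)
    have h5 := g.lt
    exact ⟨(g.left + g.right) / 2, ⟨by linarith, by linarith⟩, g, by linarith, by linarith⟩
  · push Not at hB
    have hm : (x + y) / 2 ∈ Ioo x y := ⟨by linarith, by linarith⟩
    exact ⟨_, hm, h.exists_gap_of_notMem ⟨hx.1.trans hm.1.le, hm.2.le.trans hy.2⟩ (hB _ hm)⟩

/-- An order isomorphism between the gaps induces one between the convex hulls. -/
lemma exists_hull_orderIso (h : IsCantorvalWithBoundary S B) (h' : IsCantorvalWithBoundary S' B')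
    (e : Gap B ≃o Gap B') : ∃ F : Icc (sInf B) (sSup B) ≃o Icc (sInf B') (sSup B'),
      ∀ (g : Gap B) (x : Icc (sInf B) (sSup B)), x.1 ∈ Ioo g.left g.right ↔
        (F x).1 ∈ Ioo (e g).left (e g).right := by
  classical
  set U : Set ℝ := {x | ∃ g : Gap B, x ∈ Ioo g.left g.right}
  set φ : ℝ → ℝ := fun x => if hx : x ∈ U then Gap.affine hx.choose (e hx.choose) x else 0
  have hφ : ∀ (g : Gap B) (x : ℝ), x ∈ Ioo g.left g.right → φ x = Gap.affine g (e g) x := by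
    intro g x hx
    have hxU : x ∈ U := ⟨g, hx⟩
    simp only [φ, dif_pos hxU, Gap.eq_of_mem hxU.choose_spec hx]
  have hφmem : ∀ (g : Gap B) (x : ℝ), x ∈ Ioo g.left g.right →
      φ x ∈ Ioo (e g).left (e g).right := fun g x hx => by
    rw [hφ g x hx]
    exact Gap.affine_mem g (e g) hx
  have hφhull : ∀ x ∈ U, φ x ∈ Icc (sInf B') (sSup B') := fun x ⟨g, hg⟩ =>
    h'.mem_Icc_of_mem_gap (hφmem g x hg)
  have hφmono : StrictMonoOn φ U := by
    rintro x ⟨g, hg⟩ y ⟨k, hk⟩ hxy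
    rcases lt_trichotomy g k with hlt | rfl | hlt
    · linarith [(hφmem g x hg).2, (hφmem k y hk).1, Gap.right_le_left (e.lt_iff_lt.2 hlt)]
    · rw [hφ g x hg, hφ g y hk]
      exact Gap.affine_strictMono _ _ hxy
    · linarith [hg.1, hk.2, Gap.right_le_left hlt]
  -- The extension of `φ` is the supremum of its values to the left; `sInf B'` is inserted to keep
  -- the set nonempty when no gap point precedes x.
  set T : ℝ → Set ℝ := fun x => insert (sInf B') (φ '' (U ∩ Iic x))
  have hm' : sInf B' < sSup B' := by
    obtain ⟨x, hx⟩ := h'.nonempty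
    obtain ⟨g, -⟩ := h'.inner x hx 1 one_pos
    exact (csInf_le h'.compact.bddBelow g.left_mem).trans_lt
      (g.lt.trans_le (le_csSup h'.compact.bddAbove g.right_mem))
  have hTub : ∀ x, sSup B' ∈ upperBounds (T x) := by
    rintro x _ (rfl | ⟨u, ⟨hu, -⟩, rfl⟩)
    exacts [hm'.le, (hφhull u hu).2]
  have hTbdd : ∀ x, BddAbove (T x) := fun x => ⟨_, hTub x⟩
  have hTmono : Monotone fun x => sSup (T x) := fun x y hxy =>
    csSup_le_csSup (hTbdd y) (insert_nonempty _ _)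
      (insert_subset_insert (image_mono (inter_subset_inter_right _ (Iic_subset_Iic.2 hxy))))
  have hTφ : ∀ x ∈ U, sSup (T x) = φ x := fun x hx => by
    refine le_antisymm (csSup_le (insert_nonempty _ _) ?_)
      (le_csSup (hTbdd x) (Or.inr ⟨x, ⟨hx, le_refl x⟩, rfl⟩))
    rintro _ (rfl | ⟨u, ⟨hu, hux⟩, rfl⟩)
    exacts [(hφhull x hx).1, hφmono.monotoneOn hu hx hux]
  set F : Icc (sInf B) (sSup B) → Icc (sInf B') (sSup B') := fun x =>
    ⟨sSup (T x), le_csSup (hTbdd x) (Or.inl rfl), csSup_le (insert_nonempty _ _) (hTub x)⟩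
  have hFmono : StrictMono F := by
    intro x y hxy
    -- Two gap points u < v between x and y are needed, since the suprema satisfy only weak
    -- inequalities.
    obtain ⟨u, hu, hxu⟩ := h.exists_mem_gap_between x.2 y.2 hxy
    obtain ⟨v, hv, huv⟩ := h.exists_mem_gap_between (h.mem_Icc_of_mem_gap hxu.choose_spec) y.2 hu.2
    have h1 : sSup (T x) ≤ φ u := (hTmono hu.1.le).trans_eq (hTφ u hxu)
    have h2 : φ v ≤ sSup (T y) := (hTφ v huv).symm.trans_le (hTmono hv.2.le)
    exact h1.trans_lt ((hφmono hxu huv hv.1).trans_le h2)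
  have hFgap : ∀ (g : Gap B) (y : Icc (sInf B') (sSup B')), y.1 ∈ Ioo (e g).left (e g).right →
      ∃ x : Icc (sInf B) (sSup B), x.1 ∈ Ioo g.left g.right ∧ F x = y := by
    intro g y hy
    have hx := Gap.affine_mem (e g) g hy
    refine ⟨⟨_, h.mem_Icc_of_mem_gap hx⟩, hx, Subtype.ext ?_⟩
    change sSup (T _) = _
    rw [hTφ _ ⟨g, hx⟩, hφ g _ hx, Gap.affine_affine]
  have hdense : DenseRange F := by
    have : Nontrivial (Icc (sInf B') (sSup B')) :=
      ⟨⟨_, left_mem_Icc.2 hm'.le⟩, ⟨_, right_mem_Icc.2 hm'.le⟩, fun he => hm'.ne (congrArg (·.1) he)⟩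
    refine dense_of_exists_between fun a b hab => ?_
    obtain ⟨z, hz, g, hg⟩ := h'.exists_mem_gap_between a.2 b.2 hab
    obtain ⟨x, -, hx⟩ := hFgap (e.symm g) ⟨z, h'.mem_Icc_of_mem_gap hg⟩ (by rwa [e.apply_symm_apply])
    exact ⟨_, ⟨x, hx⟩, hz.1, hz.2⟩
  have hcont : Continuous F := hFmono.monotone.continuous_of_denseRange hdense
  have hsurj : Function.Surjective F := by
    rw [← range_eq_univ, ← (isCompact_range hcont).isClosed.closure_eq]
    exact hdense.closure_range
  refine ⟨hFmono.orderIsoOfSurjective F hsurj, fun g x => ⟨fun hx => ?_, fun hx => ?_⟩⟩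
  · change sSup (T x) ∈ _
    rw [hTφ _ ⟨g, hx⟩]
    exact hφmem g _ hx
  · obtain ⟨z, hz, hzx⟩ := hFgap g (F x) hx
    rwa [← hFmono.injective hzx]

/-- Any two such sets are homeomorphic. -/
theorem nonempty_homeomorph (h : IsCantorvalWithBoundary S B)
    (h' : IsCantorvalWithBoundary S' B') : Nonempty (S ≃ₜ S') := by
  obtain ⟨e, he⟩ := exists_colouredOrderIso h.colourDense h'.colourDense
  obtain ⟨F, hF⟩ := h.exists_hull_orderIso h' e
  have hmem : ∀ {S B : Set ℝ}, IsCantorvalWithBoundary S B → ∀ {g : Gap B} {x : ℝ},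
      x ∈ Ioo g.left g.right → (x ∈ S ↔ colour S g) := fun h g x hx =>
    ⟨fun hxS => (h.gap g).resolve_right fun hd => disjoint_left.1 hd hx hxS, fun hg => hg hx⟩
  have hFS : ∀ x, x.1 ∈ S ↔ (F x).1 ∈ S' := by
    intro x
    by_cases hx : ∃ g : Gap B, x.1 ∈ Ioo g.left g.right
    · obtain ⟨g, hg⟩ := hx
      rw [hmem h hg, hmem h' ((hF g x).1 hg), he g]
    · have h1 : x.1 ∈ B := by
        by_contra hxB
        exact hx (h.exists_gap_of_notMem x.2 hxB)
      have h2 : (F x).1 ∈ B' := by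
        by_contra hxB
        obtain ⟨g, hg⟩ := h'.exists_gap_of_notMem (F x).2 hxB
        exact hx ⟨e.symm g, (hF _ x).2 (by rwa [e.apply_symm_apply])⟩
      exact ⟨fun _ => h'.subset h2, fun _ => h.subset h1⟩
  exact ⟨{
    toFun := fun x => ⟨F ⟨x, h.hull x x.2⟩, (hFS _).1 x.2⟩
    invFun := fun y => ⟨F.symm ⟨y, h'.hull y y.2⟩, (hFS _).2 (by rw [F.apply_symm_apply]; exact y.2)⟩
    left_inv := fun x => by simp only [Subtype.coe_eta, F.symm_apply_apply]
    right_inv := fun y => by simp only [Subtype.coe_eta, F.apply_symm_apply]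
    continuous_toFun := by
      have := F.continuous
      fun_prop
    continuous_invFun := by
      have := F.symm.continuous
      fun_prop }⟩

end IsCantorvalWithBoundary

/-! ### The model Cantorval -/

section Model

lemma preCantorSet_succ_mem {n : ℕ} {x : ℝ} :
    x ∈ preCantorSet (n + 1) ↔ 3 * x ∈ preCantorSet n ∨ 3 * x - 2 ∈ preCantorSet n := by
  rw [preCantorSet_succ, mem_union, mem_image, mem_image]
  refine or_congr ⟨?_, fun h => ⟨_, h, by ring⟩⟩ ⟨?_, fun h => ⟨_, h, by ring⟩⟩
  · rintro ⟨y, hy, rfl⟩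
    rwa [mul_div_cancel₀ y three_ne_zero]
  · rintro ⟨y, hy, rfl⟩
    rwa [mul_div_cancel₀ _ three_ne_zero, add_sub_cancel_left]

lemma removedThirds_one : removedThirds 1 = Ioo (1 / 3) (2 / 3) := by
  ext x
  simp only [removedThirds, Set.mem_sdiff, preCantorSet_succ_mem, Nat.sub_self, preCantorSet_zero,
    mem_Icc, mem_Ioo, not_or, not_and_or, not_le]
  constructor
  · rintro ⟨⟨h0, h1⟩, h2 | h2, h3 | h3⟩ <;> constructor <;> linarith
  · rintro ⟨h0, h1⟩
    exact ⟨⟨by linarith, by linarith⟩, Or.inr (by linarith), Or.inl (by linarith)⟩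

lemma removedThirds_succ_mem {n : ℕ} {x : ℝ} :
    x ∈ removedThirds (n + 2) ↔ 3 * x ∈ removedThirds (n + 1) ∨ 3 * x - 2 ∈ removedThirds (n + 1) := by
  have h0 : ∀ {n : ℕ} {y : ℝ}, y ∈ preCantorSet n → 0 ≤ y ∧ y ≤ 1 := fun h =>
    preCantorSet_subset_unitInterval h
  simp only [removedThirds, Set.mem_sdiff, Nat.add_sub_cancel, show n + 2 - 1 = n + 1 from rfl]
  rw [preCantorSet_succ_mem (n := n + 1), preCantorSet_succ_mem (n := n)]
  constructor
  · rintro ⟨h1 | h1, h2⟩ <;> rw [not_or] at h2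
    exacts [Or.inl ⟨h1, h2.1⟩, Or.inr ⟨h1, h2.2⟩]
  · rintro (⟨h1, h2⟩ | ⟨h1, h2⟩)
    · refine ⟨Or.inl h1, not_or.2 ⟨h2, fun h3 => ?_⟩⟩
      linarith [(h0 h1).2, (h0 h3).1]
    · refine ⟨Or.inr h1, not_or.2 ⟨fun h3 => ?_, h2⟩⟩
      linarith [(h0 h1).1, (h0 h3).2]

lemma isOpen_removedThirds (n : ℕ) : IsOpen (removedThirds (n + 1)) := by
  induction n with
  | zero =>
    rw [zero_add, removedThirds_one]
    exact isOpen_Ioo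
  | succ n ih =>
    have : removedThirds (n + 1 + 1) = (fun x => 3 * x) ⁻¹' removedThirds (n + 1) ∪
        (fun x => 3 * x - 2) ⁻¹' removedThirds (n + 1) := by
      ext x
      exact removedThirds_succ_mem
    rw [this]
    exact (ih.preimage (by fun_prop)).union (ih.preimage (by fun_prop))

lemma disjoint_removedThirds {n m : ℕ} (h : n < m) :
    Disjoint (removedThirds (n + 1)) (removedThirds (m + 1)) :=
  disjoint_left.2 fun _ hx hy => hx.2 (preCantorSet_antitone h hy.1)

lemma disjoint_cantorSet_removedThirds (n : ℕ) : Disjoint cantorSet (removedThirds (n + 1)) :=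
  disjoint_left.2 fun _ hx hy => hy.2 (mem_iInter.1 hx _)

lemma exists_mem_removedThirds {x : ℝ} (hx : x ∈ Icc (0 : ℝ) 1) (hxC : x ∉ cantorSet) :
    ∃ n, x ∈ removedThirds (n + 1) := by
  classical
  have hex : ∃ n, x ∉ preCantorSet n := by
    by_contra! h
    exact hxC (mem_iInter.2 h)
  obtain ⟨n, hn⟩ : ∃ n, Nat.find hex = n + 1 := by
    refine Nat.exists_eq_succ_of_ne_zero fun h0 => ?_
    have := Nat.find_spec hex
    rw [h0, preCantorSet_zero] at this
    exact this hx
  refine ⟨n, not_not.1 (Nat.find_min hex (m := n) (by omega)), ?_⟩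
  rw [← hn]
  exact Nat.find_spec hex

lemma cantorSet_left {x : ℝ} (hx : x ∈ cantorSet) : x / 3 ∈ cantorSet := by
  rw [cantorSet_eq_union_halves]
  exact Or.inl ⟨x, hx, rfl⟩

lemma cantorSet_right {x : ℝ} (hx : x ∈ cantorSet) : (2 + x) / 3 ∈ cantorSet := by
  rw [cantorSet_eq_union_halves]
  exact Or.inr ⟨x, hx, rfl⟩

lemma one_mem_cantorSet : (1 : ℝ) ∈ cantorSet := by
  refine mem_iInter.2 fun n => ?_
  induction n with
  | zero => simp
  | succ n ih => exact preCantorSet_succ_mem.2 (Or.inr (by norm_num; exact ih))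

/-- Near every point of the Cantor set there is a third that is removed at the step `n + 1`. -/
lemma exists_gap_removedThirds (n : ℕ) : ∀ x ∈ cantorSet, ∃ g : Gap cantorSet,
    |g.left - x| ≤ 1 / 3 ^ n ∧ |g.right - x| ≤ 1 / 3 ^ n ∧
      Ioo g.left g.right ⊆ removedThirds (n + 1) := by
  induction n with
  | zero =>
    intro x hx
    have h := cantorSet_subset_unitInterval hx
    have hsub : Ioo (1 / 3 : ℝ) (2 / 3) ⊆ removedThirds (0 + 1) := by
      rw [zero_add, removedThirds_one]
    refine ⟨⟨1 / 3, 2 / 3, cantorSet_left one_mem_cantorSet,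
      by simpa using cantorSet_right zero_mem_cantorSet, by norm_num,
      ((disjoint_cantorSet_removedThirds 0).mono_right hsub).symm⟩, ?_, ?_, hsub⟩ <;>
    · rw [pow_zero, div_one, abs_le]
      constructor <;> linarith [h.1, h.2]
  | succ n ih =>
    -- The offset `t` is 0 for the left third of the construction and 2 for the right third.
    have key : ∀ (x t : ℝ) (g : Gap cantorSet), (∀ y ∈ cantorSet, (t + y) / 3 ∈ cantorSet) →
        (∀ y, 3 * y - t ∈ removedThirds (n + 1) → y ∈ removedThirds (n + 2)) →
        |g.left - x| ≤ 1 / 3 ^ n → |g.right - x| ≤ 1 / 3 ^ n →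
        Ioo g.left g.right ⊆ removedThirds (n + 1) → ∃ g : Gap cantorSet,
        |g.left - (t + x) / 3| ≤ 1 / 3 ^ (n + 1) ∧ |g.right - (t + x) / 3| ≤ 1 / 3 ^ (n + 1) ∧
          Ioo g.left g.right ⊆ removedThirds (n + 2) := by
      intro x t g hC hR h1 h2 h3
      have hsub : Ioo ((t + g.left) / 3) ((t + g.right) / 3) ⊆ removedThirds (n + 2) := by
        rintro y ⟨hy1, hy2⟩
        exact hR y (h3 ⟨by linarith, by linarith⟩)
      have hclose : ∀ a, |a - x| ≤ 1 / 3 ^ n → |(t + a) / 3 - (t + x) / 3| ≤ 1 / 3 ^ (n + 1) := by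
        intro a ha
        rw [← sub_div, add_sub_add_left_eq_sub, abs_div, abs_of_pos (three_pos : (0 : ℝ) < 3),
          pow_succ, ← div_div]
        gcongr
      exact ⟨⟨_, _, hC _ g.left_mem, hC _ g.right_mem, by linarith [g.lt],
        ((disjoint_cantorSet_removedThirds (n + 1)).mono_right hsub).symm⟩,
        hclose _ h1, hclose _ h2, hsub⟩
    intro x hx
    rw [cantorSet_eq_union_halves] at hx
    obtain ⟨x, hx, rfl⟩ | ⟨x, hx, rfl⟩ := hx
    · obtain ⟨g, h1, h2, h3⟩ := ih x hx
      have := key x 0 g (fun y hy => by simpa using cantorSet_left hy)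
        (fun y hy => removedThirds_succ_mem.2 (Or.inl (by simpa using hy))) h1 h2 h3
      simpa using this
    · obtain ⟨g, h1, h2, h3⟩ := ih x hx
      exact key x 2 g (fun y hy => cantorSet_right hy)
        (fun y hy => removedThirds_succ_mem.2 (Or.inr hy)) h1 h2 h3

lemma isCantorvalWithBoundary_model : IsCantorvalWithBoundary modelCantorval cantorSet := by
  have hI : modelCantorval ⊆ Icc 0 1 :=
    union_subset cantorSet_subset_unitInterval (iUnion_subset fun n =>
      sdiff_subset.trans preCantorSet_subset_unitInterval)
  have hC := isCompact_cantorSet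
  have hlim : ∀ ε > (0 : ℝ), ∀ᶠ n : ℕ in atTop, 1 / (3 : ℝ) ^ n < ε := fun ε hε =>
    (tendsto_const_nhds.div_atTop (tendsto_pow_atTop_atTop_of_one_lt
      (by norm_num : (1 : ℝ) < 3))).eventually_lt_const hε
  -- The index 2n+1+1 is an even step of the construction: these thirds are left out of the model,
  -- while those of the odd steps 2n+1 are kept.
  have hodd : ∀ n, Disjoint (removedThirds (2 * n + 1 + 1)) modelCantorval := by
    intro n
    refine disjoint_union_right.2 ⟨(disjoint_cantorSet_removedThirds _).symm,
      disjoint_iUnion_right.2 fun m => ?_⟩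
    rcases lt_or_gt_of_ne (show 2 * n + 1 ≠ 2 * m by omega) with h | h
    · exact disjoint_removedThirds h
    · exact (disjoint_removedThirds h).symm
  have heven : ∀ n, removedThirds (2 * n + 1) ⊆ modelCantorval := fun n =>
    (subset_iUnion (fun n => removedThirds (2 * n + 1)) n).trans subset_union_right
  refine ⟨hC, ⟨0, zero_mem_cantorSet⟩, subset_union_left, fun x hx => ?_, fun g => ?_,
    fun x hx ε hε => ?_, fun x hx ε hε => ?_⟩
  · exact ⟨(csInf_le hC.bddBelow zero_mem_cantorSet).trans (hI hx).1,
      (hI hx).2.trans (le_csSup hC.bddAbove one_mem_cantorSet)⟩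
  -- A gap is connected and is covered by the disjoint open unions of odd-step and even-step thirds,
  -- so it lies in one of them.
  · have hcov : Ioo g.left g.right ⊆
        (⋃ n, removedThirds (2 * n + 1)) ∪ ⋃ n, removedThirds (2 * n + 1 + 1) := by
      intro x hx
      obtain ⟨n, hn⟩ := exists_mem_removedThirds (x := x)
        ⟨(cantorSet_subset_unitInterval g.left_mem).1.trans hx.1.le,
          hx.2.le.trans (cantorSet_subset_unitInterval g.right_mem).2⟩
        (disjoint_left.1 g.disjoint hx)
      obtain ⟨k, rfl | rfl⟩ := Nat.even_or_odd' n
      · exact Or.inl (mem_iUnion.2 ⟨k, hn⟩)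
      · exact Or.inr (mem_iUnion.2 ⟨k, hn⟩)
    rcases isPreconnected_Ioo.subset_or_subset (isOpen_iUnion fun n => isOpen_removedThirds (2 * n))
      (isOpen_iUnion fun n => isOpen_removedThirds (2 * n + 1))
      ((disjoint_iUnion_left.2 fun n => disjoint_iUnion_right.2 fun m =>
        ((hodd m).mono_right (heven n)).symm)) hcov with h | h
    · exact Or.inl (h.trans subset_union_right)
    · exact Or.inr ((disjoint_iUnion_left.2 hodd).mono_left h)
  · obtain ⟨n, hn⟩ := (hlim ε hε).exists_forall_of_atTop
    obtain ⟨g, h1, h2, h3⟩ := exists_gap_removedThirds (2 * n) x hx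
    have := hn (2 * n) (by omega)
    exact ⟨g, h1.trans_lt this, h2.trans_lt this, h3.trans (heven n)⟩
  · obtain ⟨n, hn⟩ := (hlim ε hε).exists_forall_of_atTop
    obtain ⟨g, h1, h2, h3⟩ := exists_gap_removedThirds (2 * n + 1) x hx
    have := hn (2 * n + 1) (by omega)
    exact ⟨g, h1.trans_lt this, h2.trans_lt this, (hodd n).mono_left h3⟩

end Model

/-! ### Assembly -/

lemma isCantorvalWithBoundary_selfSimilarK {l : ℕ} (hl : 1 ≤ l) :
    IsCantorvalWithBoundary (selfSimilarK l) (frontier (selfSimilarK l)) := by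
  have hK := isCompact_selfSimilarK l
  have hsub := hK.isClosed.frontier_subset
  have hF : IsCompact (frontier (selfSimilarK l)) := hK.of_isClosed_subset isClosed_frontier hsub
  have h0 : (0 : ℝ) ∈ frontier (selfSimilarK l) := by
    rw [frontier_selfSimilarK hl]
    exact Or.inl (zero_mem_overlapSet l)
  have h1 : 2 * (l : ℝ) / (2 * l + 1) + 1 ∈ frontier (selfSimilarK l) := by
    rw [frontier_selfSimilarK hl]
    exact Or.inr ⟨_, fixedPoint_mem_overlapSet l, rfl⟩
  refine ⟨hF, ⟨0, h0⟩, hsub, fun x hx => ?_, fun g => ?_, fun x hx ε hε => ?_, fun x hx ε hε => ?_⟩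
  · have hb := selfSimilarK_bounds hx
    exact ⟨(csInf_le hF.bddBelow h0).trans hb.1,
      (hb.2.trans_eq (add_comm _ _)).trans (le_csSup hF.bddAbove h1)⟩
  -- A connected set missing the boundary lies in the interior or in the complement.
  · have hcov : Ioo g.left g.right ⊆ interior (selfSimilarK l) ∪ (selfSimilarK l)ᶜ := by
      intro x hx
      by_cases hxK : x ∈ selfSimilarK l
      · refine Or.inl (not_not.1 fun hxi => disjoint_left.1 g.disjoint hx ?_)
        rw [hK.isClosed.frontier_eq]
        exact ⟨hxK, hxi⟩
      · exact Or.inr hxK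
    rcases isPreconnected_Ioo.subset_or_subset isOpen_interior hK.isClosed.isOpen_compl
      (disjoint_compl_right.mono_left interior_subset) hcov with h | h
    · exact Or.inl (h.trans interior_subset)
    · exact Or.inr (subset_compl_iff_disjoint_right.1 h)
  · obtain ⟨⟨a, ha, b, hb, hab, hax, hbx, hd, hin⟩, -⟩ := exists_gaps_frontier hl hx hε
    exact ⟨⟨a, b, ha, hb, hab, hd⟩, hax, hbx, hin⟩
  · obtain ⟨-, a, ha, b, hb, hab, hax, hbx, hd, hout⟩ := exists_gaps_frontier hl hx hε
    exact ⟨⟨a, b, ha, hb, hab, hd⟩, hax, hbx, hout⟩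

theorem mainTheorem1 (l : ℕ) (hl : 1 ≤ l) :
    IsCantorval (selfSimilarK l) ∧
    MeasureTheory.volume (selfSimilarK l) = 1 ∧
    dimH (frontier (selfSimilarK l)) =
      ENNReal.ofReal (Real.log (2 * (l : ℝ) + 1) / Real.log (2 * (l : ℝ) + 2)) ∧
    (¬ ∃ m : ℤ, Real.log (2 * (l : ℝ) + 1) / Real.log (2 * (l : ℝ) + 2) = (m : ℝ)) ∧
    -- there are `2l` outer indices, and `copyMap l n i` is a similarity of ratio `(2l+2)^{-(n+1)}`
    (outerIndices l).card = 2 * l ∧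
    (∀ n : ℕ, ∀ i ∈ outerIndices l, ∀ x y : ℝ,
      dist (copyMap l n i x) (copyMap l n i y) = ((2 * (l : ℝ) + 2) ^ (n + 1))⁻¹ * dist x y) ∧
    -- the copies of the boundary are pairwise disjoint
    {p : ℕ × ℕ | p.2 ∈ outerIndices l}.PairwiseDisjoint
      (fun p => copyMap l p.1 p.2 '' frontier (selfSimilarK l)) ∧
    -- they fill the boundary up to two of its points, which are limits of the copies
    ({2 * (l : ℝ) / (2 * (l : ℝ) + 1), 1} : Set ℝ) ⊆ frontier (selfSimilarK l) ∧
    (⋃ n : ℕ, ⋃ i ∈ outerIndices l, copyMap l n i '' frontier (selfSimilarK l)) =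
      frontier (selfSimilarK l) \ {2 * (l : ℝ) / (2 * (l : ℝ) + 1), 1} ∧
    closure (⋃ n : ℕ, ⋃ i ∈ outerIndices l, copyMap l n i '' frontier (selfSimilarK l)) =
      frontier (selfSimilarK l) := by
  refine ⟨(isCantorvalWithBoundary_selfSimilarK hl).nonempty_homeomorph isCantorvalWithBoundary_model,
    volume_selfSimilarK (volume_overlapSet hl), dimH_frontier_selfSimilarK hl,
    boundaryDim_ne_int hl, card_outerIndices l, fun n i _ x y => dist_copyMap n i x y,
    pairwiseDisjoint_copies hl, fixedPoints_mem_frontier hl, iUnion_copies hl, ?_⟩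
  rw [iUnion_copies hl, closure_frontier_diff hl]
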